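/- **Conventions.** Let $n\ge 0$, $r_0,\dots,r_n\ge 0$ and $d=r_0+\cdots+r_n$. A permutation $v\in S_d$ is identified with the $d\times d$ matrix with ones at $(p,v(p))$. Let $l(v)$ be its number of inversions and $s_i$ the transposition of $i$ and $i+1$. Divide the $d\times d$ grid into blocks $B_{ji}$ ($0\le i,j\le n$), where the $j$-th block row from the top has height $r_j$ and the $i$-th block column from the right has width $r_i$. The permutation $v$ is a *Zelevinsky permutation* if $B_{ji}$ contains no ones of $v$ for $i\ge j+2$, and the ones of $v$ proceed from northwest to southeast within every block row and every block column. Its rank array $\mathbf r=(r_{ij})_{i\le j}$, where $r_{ij}$ is the number of ones of $v$ in the blocks $B_{qp}$ with $q\ge j$, $p\le i$, determines $v$, and we write $v=v(\mathbf r)$. Let $v(\mathrm{Hom})$ be the Zelevinsky permutation whose rank array is entrywise maximal among those of all Zelevinsky permutations for $r_0,\dots,r_n$. The double Grothendieck polynomials $\mathcal G_v(\mathbf z/\dot{\mathbf z})$, $v\in S_d$, are given by $\mathcal G_{w_0}=\prod_{i+j\le d}(1-z_i/\dot z_j)$ for the longest permutation $w_0$, and $\mathcal G_{vs_i}=\partial_i\mathcal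 G_v$ whenever $v(i)>v(i+1)$, where $$\partial_i f=\frac{z_{i+1}f(z_i,z_{i+1})-z_if(z_{i+1},z_i)}{z_{i+1}-z_i}.$$ Put $\mathbf z=\mathbf x=\mathbf x^0,\dots,\mathbf x^n$ and $\dot{\mathbf z}=\mathring{\mathbf y}=\mathbf y^n,\dots,\mathbf y^0$, where $\mathbf x^j=x^j_1,\dots,x^j_{r_j}$ and $\mathbf y^j=y^j_1,\dots,y^j_{r_j}$, and define the double quiver $K$-polynomial $$K\mathcal Q_{\mathbf r}(\mathbf x/\mathring{\mathbf y})=\mathcal G_{v(\mathbf r)}(\mathbf x/\mathring{\mathbf y})\,/\,\mathcal G_{v(\mathrm{Hom})}(\mathbf x/\mathring{\mathbf y}).$$ A *pipe dream* is a set $P$ of cells (crosses) of the $d\times d$ grid. Its word is obtained by reading the crosses along rows from right to left, starting from the top row and proceeding downward, a cross at $(p,q)$ giving the letter $s_{p+q-1}$; its Demazure product $\delta(P)\in S_\infty$ is obtained from the identity by multiplying on the right successively by the letters of the word, omitting each letter that would decrease length. Let $D_{\mathrm{Hom}}$ be the set of all cells in the blocks $B_{ji}$ with $i\ge j+2$.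 For a pipe dream $P$, put $$(\mathbf 1-\tilde{\mathbf x}/\tilde{\mathbf y})^{P}=\prod_{+\in P}(1-\tilde x_+/\tilde y_+),$$ where $\tilde x_+$ (resp. $\tilde y_+$) is the variable labelling the row (resp. column) of the cross $+$ when the rows are labelled from top to bottom by $\mathbf x^0,\dots,\mathbf x^n$ and the columns from left to right by $\mathbf y^n,\dots,\mathbf y^0$ with each single alphabet $\mathbf x^j$, $\mathbf y^j$ written in reverse order. **Theorem (Pipe formula).** There is exactly one permutation $v(\mathrm{Hom})$ as above, $\mathcal G_{v(\mathrm{Hom})}\ne 0$, and for every Zelevinsky permutation $v(\mathbf r)$ $$K\mathcal Q_{\mathbf r}(\mathbf x/\mathring{\mathbf y})=\sum_{\delta(P)=v(\mathbf r)}(-1)^{|P|-l(v(\mathbf r))}\,(\mathbf 1-\tilde{\mathbf x}/\tilde{\mathbf y})^{P\smallsetminus D_{\mathrm{Hom}}},$$ the sum being over all (possibly nonreduced) $d\times d$ pipe dreams $P$ with Demazure product $v(\mathbf r)$. Consequently, $\mathcal G_{v(\mathrm{Hom})}(\mathbf x/\mathring{\mathbf y})$ divides $\mathcal G_{v(\mathbf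 r)}(\mathbf x/\mathring{\mathbf y})$ in the ring of Laurent polynomials over $\mathbb Z$ in the variables $\mathbf x,\mathbf y$. -/

import Mathlib

/-! ### Rational functions, Demazure operators, double Grothendieck polynomials

Indices start at `0`: row `p`, column `q` and the variables `z p`, `ż q` correspond to
`p + 1`, `q + 1` in the usual numbering. A permutation matrix `v` has its ones at `(p, v p)`. -/

/-- The field of rational functions over `ℤ` in two alphabets of size `d`. -/
abbrev RatFun (d : ℕ) : Type := FractionRing (MvPolynomial (Fin d ⊕ Fin d) ℤ)

/-- The variable `z_p` of the first alphabet (labelling row `p`). -/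
noncomputable def zVar {d : ℕ} (p : Fin d) : RatFun d :=
  algebraMap (MvPolynomial (Fin d ⊕ Fin d) ℤ) (RatFun d) (MvPolynomial.X (Sum.inl p))

/-- The variable `ż_q` of the second alphabet (labelling column `q`). -/
noncomputable def zDot {d : ℕ} (q : Fin d) : RatFun d :=
  algebraMap (MvPolynomial (Fin d ⊕ Fin d) ℤ) (RatFun d) (MvPolynomial.X (Sum.inr q))

/-- The Laurent polynomials in the two alphabets, as a subring of the rational functions. -/
noncomputable def laurentRing (d : ℕ) : Subring (RatFun d) :=
  Subring.closure (Set.range zVar ∪ Set.range (fun p : Fin d => (zVar p)⁻¹) ∪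
    Set.range zDot ∪ Set.range (fun q : Fin d => (zDot q)⁻¹))

/-- The automorphism of the rational functions exchanging `z_a` and `z_b`. -/
noncomputable def swapZ {d : ℕ} (a b : Fin d) : RatFun d ≃+* RatFun d :=
  IsFractionRing.ringEquivOfRingEquiv
    (MvPolynomial.renameEquiv ℤ (Equiv.swap (Sum.inl a : Fin d ⊕ Fin d) (Sum.inl b))).toRingEquiv

/-- The Demazure operator attached to the adjacent variables `z_a`, `z_b`, `b = a + 1`. -/
noncomputable def demazureOp {d : ℕ} (a b : Fin d) (f : RatFun d) : RatFun d :=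
  (zVar b * f - zVar a * swapZ a b f) / (zVar b - zVar a)

/-- `IsDoubleGrothendieck v f`: the function `f` is obtained for `v ∈ S_d` from the top double
Grothendieck polynomial `∏_{i + j ≤ d} (1 - z_i / ż_j)` of the longest permutation by the recursion
`𝒢_{v s_i} = ∂_i 𝒢_v` whenever `v s_i < v`, that is, whenever `v(i) > v(i+1)`. -/
inductive IsDoubleGrothendieck {d : ℕ} : Equiv.Perm (Fin d) → RatFun d → Prop
  | top : IsDoubleGrothendieck Fin.revPerm
      (∏ c ∈ (Finset.univ : Finset (Fin d × Fin d)).filter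
        (fun c => ((c.1 : ℕ) + 1) + ((c.2 : ℕ) + 1) ≤ d), (1 - zVar c.1 / zDot c.2))
  | step {v : Equiv.Perm (Fin d)} {f : RatFun d} (a b : Fin d) (hab : (b : ℕ) = (a : ℕ) + 1)
      (hf : IsDoubleGrothendieck v f) (hv : v b < v a) :
      IsDoubleGrothendieck (v * Equiv.swap a b) (demazureOp a b f)

theorem sum_mul_swap_lt {d : ℕ} (v : Equiv.Perm (Fin d)) (a b : Fin d)
    (hab : (b : ℕ) = (a : ℕ) + 1) (hv : v a < v b) :
    ∑ p : Fin d, (p : ℕ) * ((v * Equiv.swap a b) p : ℕ) < ∑ p : Fin d, (p : ℕ) * (v p : ℕ) := by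
  have hne : a ≠ b := by
    intro h
    rw [h] at hab
    omega
  have hb : b ∈ (Finset.univ : Finset (Fin d)).erase a := by simp [hne.symm]
  rw [← Finset.add_sum_erase _ _ (Finset.mem_univ a),
    ← Finset.add_sum_erase _ (fun p : Fin d => (p : ℕ) * (v p : ℕ)) (Finset.mem_univ a),
    ← Finset.add_sum_erase _ _ hb,
    ← Finset.add_sum_erase _ (fun p : Fin d => (p : ℕ) * (v p : ℕ)) hb]
  have hrest : ∑ p ∈ ((Finset.univ : Finset (Fin d)).erase a).erase b,
      (p : ℕ) * ((v * Equiv.swap a b) p : ℕ) =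
      ∑ p ∈ ((Finset.univ : Finset (Fin d)).erase a).erase b, (p : ℕ) * (v p : ℕ) := by
    refine Finset.sum_congr rfl fun p hp => ?_
    simp only [Finset.mem_erase, Finset.mem_univ, and_true] at hp
    rw [Equiv.Perm.mul_apply, Equiv.swap_apply_of_ne_of_ne hp.2 hp.1]
  rw [hrest]
  simp only [Equiv.Perm.mul_apply, Equiv.swap_apply_left, Equiv.swap_apply_right]
  have h1 : (v a : ℕ) < (v b : ℕ) := hv
  rw [hab]
  nlinarith

theorem exists_isDoubleGrothendieck {d : ℕ} (v : Equiv.Perm (Fin d)) :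
    ∃ f, IsDoubleGrothendieck v f := by
  induction hm : ∑ p : Fin d, (p : ℕ) * (v p : ℕ) using Nat.strong_induction_on generalizing v with
  | _ m ih =>
    by_cases h : ∃ a b : Fin d, (b : ℕ) = (a : ℕ) + 1 ∧ v a < v b
    · obtain ⟨a, b, hab, hv⟩ := h
      obtain ⟨f, hf⟩ := ih _ (hm ▸ sum_mul_swap_lt v a b hab hv) (v * Equiv.swap a b) rfl
      refine ⟨demazureOp a b f, ?_⟩
      have := IsDoubleGrothendieck.step a b hab hf (by simpa using hv)
      rwa [mul_assoc, Equiv.swap_mul_self, mul_one] at this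
    · push Not at h
      have hanti : StrictAnti v := by
        have hA : Antitone v := by
          cases d with
          | zero => exact fun p => p.elim0
          | succ d =>
            refine Fin.antitone_iff_succ_le.2 fun i => ?_
            exact h i.castSucc i.succ (by simp)
        exact hA.strictAnti_of_injective v.injective
      have hmono : StrictMono (v.trans Fin.revPerm) := fun p q hpq =>
        Fin.rev_lt_rev.2 (hanti hpq)
      have hv : v = Fin.revPerm := by
        apply Equiv.ext
        intro p
        have h1 : (v.trans Fin.revPerm) p = p := congrArg (fun e : Fin d ≃o Fin d => e p)
          (Subsingleton.elim (hmono.orderIsoOfSurjective _ (v.trans Fin.revPerm).surjective)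
            (OrderIso.refl _))
        have h2 : Fin.rev (v p) = p := h1
        rw [Fin.revPerm_apply, ← Fin.rev_rev (v p), h2]
      rw [hv]
      exact ⟨_, IsDoubleGrothendieck.top⟩

/-- The double Grothendieck polynomial `𝒢_v(z/ż)` of `v ∈ S_d`. -/
noncomputable def doubleGrothendieck {d : ℕ} (v : Equiv.Perm (Fin d)) : RatFun d :=
  Classical.choose (exists_isDoubleGrothendieck v)

/-- The length of a permutation: its number of inversions. -/
def permLength {d : ℕ} (v : Equiv.Perm (Fin d)) : ℕ :=
  ((Finset.univ : Finset (Fin d × Fin d)).filter (fun c => c.1 < c.2 ∧ v c.2 < v c.1)).card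

/-! ### Pipe dreams and Demazure products -/

/-- A `d × d` pipe dream, given by its set of crosses `(row, column)`. -/
abbrev PipeDream (d : ℕ) : Type := Finset (Fin d × Fin d)

/-- The word of a pipe dream: the antidiagonal indices of its crosses, each row being read from
right to left, from the top row downward. The letter `i` stands for the transposition of
`i` and `i + 1` (indices from `0`). -/
def PipeDream.word {d : ℕ} (P : PipeDream d) : List ℕ :=
  (List.finRange d).flatMap fun p =>
    ((List.finRange d).reverse.filter fun q => (p, q) ∈ P).map fun q => (p : ℕ) + (q : ℕ)

/-- Right multiplication by `s_i` in the Demazure product: `π ↦ π s_i` if this increases the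
length, and `π ↦ π` otherwise. -/
def demazureStep (π : Equiv.Perm ℕ) (i : ℕ) : Equiv.Perm ℕ :=
  if π i < π (i + 1) then π * Equiv.swap i (i + 1) else π

/-- The Demazure product `δ(P)`, an element of `S_∞` inside the permutations of `ℕ`. -/
def PipeDream.demazureProduct {d : ℕ} (P : PipeDream d) : Equiv.Perm ℕ :=
  P.word.foldl demazureStep 1

/-- The inclusion of `S_d` in `S_∞`. -/
def toInfPerm {d : ℕ} (v : Equiv.Perm (Fin d)) : Equiv.Perm ℕ :=
  v.extendDomain Fin.equivSubtype

open scoped Classical in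
/-- The set `𝒫(v)` of (possibly nonreduced) pipe dreams with Demazure product `v ∈ S_d`. -/
noncomputable def pipeDreams {d : ℕ} (v : Equiv.Perm (Fin d)) : Finset (PipeDream d) :=
  (Finset.univ : Finset (PipeDream d)).filter fun P => P.demazureProduct = toInfPerm v

/-! ### Block decompositions and Zelevinsky permutations

Throughout, `r = (r_0, …, r_n)` and `d = r_0 + ⋯ + r_n`. -/

/-- The index `j` of the block row (numbered from the top, of heights `r_0, …, r_n`) containing
row `p`. -/
def rowBlock {n : ℕ} (r : Fin (n + 1) → ℕ) (p : Fin (∑ j, r j)) : Fin (n + 1) :=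
  (finSigmaFinEquiv.symm p).1

/-- The index `i` of the block column (numbered from the right, of widths `r_0, …, r_n`) containing
column `q`. -/
def colBlock {n : ℕ} (r : Fin (n + 1) → ℕ) (q : Fin (∑ j, r j)) : Fin (n + 1) :=
  rowBlock r q.rev

/-- Reversal of each of the row alphabets: the `a`-th row of a block row is sent to the
`a`-th row from its bottom. -/
def revRow {n : ℕ} (r : Fin (n + 1) → ℕ) (p : Fin (∑ j, r j)) : Fin (∑ j, r j) :=
  finSigmaFinEquiv ⟨(finSigmaFinEquiv.symm p).1, (finSigmaFinEquiv.symm p).2.rev⟩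

/-- Reversal of each of the column alphabets. -/
def revCol {n : ℕ} (r : Fin (n + 1) → ℕ) (q : Fin (∑ j, r j)) : Fin (∑ j, r j) :=
  (revRow r q.rev).rev

/-- `v` is a Zelevinsky permutation: the block `B_{ji}` in block row `j` and block column `i`
vanishes if `i ≥ j + 2`, and the ones of `v` proceed from northwest to southeast within every block
row and within every block column. -/
structure IsZelevinsky {n : ℕ} (r : Fin (n + 1) → ℕ) (v : Equiv.Perm (Fin (∑ j, r j))) : Prop where
  zero_block : ∀ p, ¬ ((rowBlock r p : ℕ) + 2 ≤ (colBlock r (v p) : ℕ))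
  row_block : ∀ p p', rowBlock r p = rowBlock r p' → p < p' → v p < v p'
  col_block : ∀ p p', colBlock r (v p) = colBlock r (v p') → p < p' → v p < v p'

/-- The rank `r_{ij}` (`i ≤ j`) of `v`: the number of ones of `v` in the blocks weakly southeast
of `B_{ji}`. -/
def rankArray {n : ℕ} (r : Fin (n + 1) → ℕ) (v : Equiv.Perm (Fin (∑ j, r j)))
    (i j : Fin (n + 1)) : ℕ :=
  ((Finset.univ : Finset (Fin (∑ j, r j))).filter
    fun p => j ≤ rowBlock r p ∧ colBlock r (v p) ≤ i).card

/-- `h` is the Zelevinsky permutation `v(Hom)`: its rank array is maximal. -/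
def IsZelevinskyHom {n : ℕ} (r : Fin (n + 1) → ℕ) (h : Equiv.Perm (Fin (∑ j, r j))) : Prop :=
  IsZelevinsky r h ∧
    ∀ v, IsZelevinsky r v → ∀ i j, i ≤ j → rankArray r v i j ≤ rankArray r h i j

/-- The shape `D_Hom` of all locations strictly above the block superantidiagonal, i.e. in the
blocks `B_{ji}` with `i ≥ j + 2`. -/
def dHom {n : ℕ} (r : Fin (n + 1) → ℕ) : PipeDream (∑ j, r j) :=
  (Finset.univ : Finset (Fin (∑ j, r j) × Fin (∑ j, r j))).filter
    fun c => (rowBlock r c.1 : ℕ) + 2 ≤ (colBlock r c.2 : ℕ)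

/-- The exponential reverse monomial `(1 - x̃/ỹ)^P`. The alphabet `x = x^0, …, x^n` is `z`, the
alphabet `y = y^n, …, y^0` is `ż`. -/
noncomputable def expRevMonomial {n : ℕ} (r : Fin (n + 1) → ℕ) (P : PipeDream (∑ j, r j)) :
    RatFun (∑ j, r j) :=
  ∏ c ∈ P, (1 - zVar (revRow r c.1) / zDot (revCol r c.2))

/-- The ratio `𝒢_v(x/y) / 𝒢_h(x/y)`; for `v = v(𝐫)` and `h = v(Hom)` this is the double quiver
`K`-polynomial. -/
noncomputable def quiverKPolynomial {d : ℕ} (v h : Equiv.Perm (Fin d)) : RatFun d :=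
  doubleGrothendieck v / doubleGrothendieck h

/-!
# The pipe formula for double quiver `K`-polynomials

For every `v ∈ S_d` the double Grothendieck polynomial has the Fomin–Kirillov expansion
`𝒢_v = ∑ (-1) ^ (|P| - l(v)) ∏_{(p, q) ∈ P} (1 - z_p / ż_q)` over the pipe dreams `P` with Demazure
product `v` (`IsDoubleGrothendieck.eq_pipeSum`). To see this, let the 0-Hecke monoid act on
functions on `S_∞` by operators `D_i`, and give the cell `(p, q)` the factor
`1 - (1 - z_p / ż_q) D_{p+q}`. The coefficients of the product of all factors in reading order are
the sums over pipe dreams (`heckeGrid_single_apply_one`). The factors satisfy the Yang–Baxter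
equation, so the factor `1 - (1 - z_{a+1} / z_a) D_a` can be moved from right to left across the
grid, and doing so exchanges the variables `z_a` and `z_{a+1}` (`heckeGrid_mul_heckeFactor`). At a
descent `a` of `v` this is the Demazure recursion. At an ascent of `v` it is symmetry in `z_a` and
`z_{a+1}`; columns are treated in the same way (`heckeFactor_mul_heckeGrid`).

A Zelevinsky permutation has only ascents within a block row, and its inverse has only ascents
within a block column. Its Grothendieck polynomial is therefore symmetric in each alphabet, and all
the alphabets may be reversed in the expansion (`IsZelevinsky.pipeSum_comp_rev`).

A pipe dream for `v` contains every northwest rectangle free of ones of `v`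
(`mem_of_mem_pipeDreams`): reading the rows one after another, a value `> q` can reach the
position `p` only by crossing all values `≤ q`. Hence the pipe dreams of a Zelevinsky permutation
contain `D_Hom`, which is a partition shape. The dominant permutation of a partition shape has
that shape as its only pipe dream (`IsDominantFor.pipeDreams_eq`), and the dominant permutation of
`D_Hom` is the unique Zelevinsky permutation of maximal ranks
(`isZelevinskyHom_iff_isDominantFor`). So `𝒢_{v(Hom)}` is the product over `D_Hom`, a common
factor of all terms of the expansion of `𝒢_v`.
-/

/-! ### The 0-Hecke action and the Yang–Baxter equation -/

/-- One step of the Demazure product sorts the two adjacent entries into decreasing order. -/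
theorem demazureStep_apply (π : Equiv.Perm ℕ) (i k : ℕ) :
    demazureStep π i k =
      if k = i then max (π i) (π (i + 1)) else if k = i + 1 then min (π i) (π (i + 1)) else π k := by
  unfold demazureStep
  split_ifs with h1 h2 h3 h2 h3
  · subst h2; simp [h1.le]
  · subst h3; simp [h1.le]
  · simp [Equiv.swap_apply_of_ne_of_ne h2 h3]
  · subst h2; simp [not_lt.1 h1]
  · subst h3; simp [not_lt.1 h1]
  · rfl

theorem demazureStep_self (π : Equiv.Perm ℕ) (i : ℕ) :
    demazureStep (demazureStep π i) i = demazureStep π i := by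
  ext k
  simp only [demazureStep_apply]
  grind

theorem demazureStep_comm (π : Equiv.Perm ℕ) {i j : ℕ} (hij : i + 2 ≤ j) :
    demazureStep (demazureStep π i) j = demazureStep (demazureStep π j) i := by
  ext k
  simp only [demazureStep_apply]
  grind

theorem demazureStep_braid (π : Equiv.Perm ℕ) (i : ℕ) :
    demazureStep (demazureStep (demazureStep π i) (i + 1)) i =
      demazureStep (demazureStep (demazureStep π (i + 1)) i) (i + 1) := by
  ext k
  simp only [demazureStep_apply]
  grind

/-- The operator `F ↦ (π ↦ F (π ∗ s_i))` on functions on `S_∞`, where `∗` is the Demazure product.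
These operators represent the 0-Hecke monoid. -/
def demazureEnd (K : Type*) [CommSemiring K] (i : ℕ) : Module.End K (Equiv.Perm ℕ → K) :=
  LinearMap.funLeft K K fun π => demazureStep π i

section YangBaxter

variable {K : Type*} [CommRing K]

@[simp]
theorem demazureEnd_apply (i : ℕ) (F : Equiv.Perm ℕ → K) (π : Equiv.Perm ℕ) :
    demazureEnd K i F π = F (demazureStep π i) := rfl

theorem demazureEnd_mul_self (i : ℕ) : demazureEnd K i * demazureEnd K i = demazureEnd K i := by
  ext F π
  simp [demazureStep_self]

theorem demazureEnd_commute {i j : ℕ} (hij : i + 2 ≤ j) :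
    Commute (demazureEnd K i) (demazureEnd K j) := by
  ext F π
  simp [demazureStep_comm π hij]

theorem demazureEnd_braid (i : ℕ) :
    demazureEnd K i * demazureEnd K (i + 1) * demazureEnd K i =
      demazureEnd K (i + 1) * demazureEnd K i * demazureEnd K (i + 1) := by
  ext F π
  simp [demazureStep_braid]

/-- The factor `1 - (1 - a) D_i` attached to a cell on the `i`-th antidiagonal, where `a` is the
ratio of the row variable and the column variable of the cell. -/
def heckeFactor (i : ℕ) (a : K) : Module.End K (Equiv.Perm ℕ → K) :=
  1 - (1 - a) • demazureEnd K i

theorem heckeFactor_apply (i : ℕ) (a : K) (F : Equiv.Perm ℕ → K) (π : Equiv.Perm ℕ) :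
    heckeFactor i a F π = F π - (1 - a) * F (demazureStep π i) := rfl

theorem heckeFactor_commute {i j : ℕ} (hij : i + 2 ≤ j) (a b : K) :
    Commute (heckeFactor i a) (heckeFactor j b) := by
  unfold heckeFactor
  exact ((Commute.one_left _).sub_left
    (((Commute.one_right _).sub_right ((demazureEnd_commute hij).smul_right _)).smul_left _))

/-- An idempotent pair satisfying the braid relation satisfies the Yang–Baxter equation for the
multiplicative formal group law. -/
theorem yangBaxter_of_braid {A : Type*} [Ring A] [Algebra K A] {S T : A} (hS : S * S = S)
    (hT : T * T = T) (hST : S * T * S = T * S * T) (a b : K) :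
    (1 - (1 - a) • S) * (1 - (1 - a * b) • T) * (1 - (1 - b) • S) =
      (1 - (1 - b) • T) * (1 - (1 - a * b) • S) * (1 - (1 - a) • T) := by
  simp only [mul_sub, sub_mul, mul_one, one_mul, smul_mul_assoc, mul_smul_comm, hS, hT,
    hST]
  module

theorem heckeFactor_yangBaxter (i : ℕ) (a b : K) :
    heckeFactor i a * heckeFactor (i + 1) (a * b) * heckeFactor i b =
      heckeFactor (i + 1) b * heckeFactor i (a * b) * heckeFactor (i + 1) a :=
  yangBaxter_of_braid (demazureEnd_mul_self i) (demazureEnd_mul_self (i + 1))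
    (demazureEnd_braid i) a b

/-- The product of the factors of the cells `(p, n - 1), …, (p, 0)` of row `p`, read from right to
left; the row variable is `z` and the inverses of the column variables are `t`. -/
def heckeRow (t : ℕ → K) (p : ℕ) (z : K) (n : ℕ) : Module.End K (Equiv.Perm ℕ → K) :=
  ((List.range n).reverse.map fun q => heckeFactor (p + q) (z * t q)).prod

/-- The product of the factors of all cells of an `m × n` grid in reading order. -/
def heckeGrid (u t : ℕ → K) (n m : ℕ) : Module.End K (Equiv.Perm ℕ → K) :=
  ((List.range m).map fun p => heckeRow t p (u p) n).prod

theorem heckeRow_zero (t : ℕ → K) (p : ℕ) (z : K) : heckeRow t p z 0 = 1 := by simp [heckeRow]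

theorem heckeRow_succ (t : ℕ → K) (p : ℕ) (z : K) (n : ℕ) :
    heckeRow t p z (n + 1) = heckeFactor (p + n) (z * t n) * heckeRow t p z n := by
  simp [heckeRow, List.range_succ]

theorem heckeGrid_succ (u t : ℕ → K) (n m : ℕ) :
    heckeGrid u t n (m + 1) = heckeGrid u t n m * heckeRow t m (u m) n := by
  simp [heckeGrid, List.range_succ]

theorem heckeRow_commute_high (t : ℕ → K) (p : ℕ) (z : K) (n : ℕ) {i : ℕ} (hi : p + n + 1 ≤ i)
    (a : K) : Commute (heckeRow t p z n) (heckeFactor i a) := by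
  induction n with
  | zero => rw [heckeRow_zero]; exact Commute.one_left _
  | succ n ih =>
    rw [heckeRow_succ]
    exact (heckeFactor_commute (by omega) _ _).mul_left (ih (by omega))

theorem heckeRow_commute_low (t : ℕ → K) (p : ℕ) (z : K) (n : ℕ) {i : ℕ} (hi : i + 2 ≤ p)
    (a : K) : Commute (heckeRow t p z n) (heckeFactor i a) := by
  induction n with
  | zero => rw [heckeRow_zero]; exact Commute.one_left _
  | succ n ih =>
    rw [heckeRow_succ]
    exact ((heckeFactor_commute (by omega) _ _).symm).mul_left ih

theorem heckeGrid_commute_high (u t : ℕ → K) (n m : ℕ) {i : ℕ} (hi : m + n ≤ i)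
    (a : K) : Commute (heckeGrid u t n m) (heckeFactor i a) := by
  induction m with
  | zero => simp [heckeGrid]
  | succ m ih =>
    rw [heckeGrid_succ]
    exact (ih (by omega)).mul_left (heckeRow_commute_high _ _ _ _ (by omega) _)

theorem heckeGrid_congr {u u' t t' : ℕ → K} {n m : ℕ} (hu : ∀ p < m, u p = u' p)
    (ht : ∀ q < n, t q = t' q) : heckeGrid u t n m = heckeGrid u' t' n m := by
  unfold heckeGrid heckeRow
  congr 1
  refine List.map_congr_left fun p hp => ?_
  congr 1
  refine List.map_congr_left fun q hq => ?_
  rw [hu p (List.mem_range.1 hp), ht q (by simpa using hq)]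

/-- Two consecutive rows exchange their variables when a factor is moved across them from the
right end to the left end. -/
theorem heckeRow_mul_heckeRow (t : ℕ → K) (p : ℕ) (z c : K) (n : ℕ) :
    heckeRow t p z n * heckeRow t (p + 1) (z * c) n * heckeFactor p c =
      heckeFactor (p + n) c * (heckeRow t p (z * c) n * heckeRow t (p + 1) z n) := by
  induction n with
  | zero => simp [heckeRow_zero]
  | succ n ih =>
    have h1 := heckeRow_commute_high t p z n (i := p + 1 + n) (by omega) (z * c * t n)
    have h2 := heckeRow_commute_high t p (z * c) n (i := p + 1 + n) (by omega) (z * t n)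
    have hyb := heckeFactor_yangBaxter (p + n) (z * t n) c
    rw [heckeRow_succ, heckeRow_succ, heckeRow_succ, heckeRow_succ]
    calc _ = heckeFactor (p + n) (z * t n) *
          (heckeRow t p z n * heckeFactor (p + 1 + n) (z * c * t n)) *
            heckeRow t (p + 1) (z * c) n * heckeFactor p c := by noncomm_ring
      _ = heckeFactor (p + n) (z * t n) * heckeFactor (p + 1 + n) (z * c * t n) *
          (heckeRow t p z n * heckeRow t (p + 1) (z * c) n * heckeFactor p c) := by
        rw [h1.eq]; noncomm_ring
      _ = (heckeFactor (p + n) (z * t n) * heckeFactor (p + n + 1) (z * t n * c) *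
          heckeFactor (p + n) c) * (heckeRow t p (z * c) n * heckeRow t (p + 1) z n) := by
        rw [ih, show p + 1 + n = p + n + 1 by omega, mul_right_comm z c]; noncomm_ring
      _ = heckeFactor (p + n + 1) c * heckeFactor (p + n) (z * c * t n) *
          (heckeFactor (p + 1 + n) (z * t n) * heckeRow t p (z * c) n) *
            heckeRow t (p + 1) z n := by
        rw [hyb, show p + 1 + n = p + n + 1 by omega, mul_right_comm z c]; noncomm_ring
      _ = _ := by rw [← h2.eq, show p + n + 1 = p + (n + 1) by omega]; noncomm_ring

/-- A factor moved across the whole grid from right to left exchanges the variables of two adjacent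
rows and emerges on an antidiagonal beyond those of `S_d`. -/
theorem heckeGrid_mul_heckeFactor (u t : ℕ → K) (n m a : ℕ) (c : K) (hc : u (a + 1) = u a * c)
    (hm : a + 2 ≤ m) :
    heckeGrid u t n m * heckeFactor a c =
      heckeFactor (a + n) c * heckeGrid (u ∘ Equiv.swap a (a + 1)) t n m := by
  induction m, hm using Nat.le_induction with
  | base =>
    have h0 : heckeGrid (u ∘ Equiv.swap a (a + 1)) t n a = heckeGrid u t n a :=
      heckeGrid_congr (fun p hp => by
        simp [Equiv.swap_apply_of_ne_of_ne (show p ≠ a by omega) (show p ≠ a + 1 by omega)])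
        fun _ _ => rfl
    simp only [heckeGrid_succ, h0, Function.comp_apply, Equiv.swap_apply_left,
      Equiv.swap_apply_right, hc]
    rw [mul_assoc, mul_assoc, ← mul_assoc (heckeRow _ _ _ _), heckeRow_mul_heckeRow, ← mul_assoc,
      (heckeGrid_commute_high u t n a (i := a + n) le_rfl c).eq]
    noncomm_ring
  | succ m hm ih =>
    rw [heckeGrid_succ, heckeGrid_succ, mul_assoc,
      (heckeRow_commute_low t m (u m) n (by omega) c).eq, ← mul_assoc, ih, Function.comp_apply,
      Equiv.swap_apply_of_ne_of_ne (by omega) (by omega), mul_assoc]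

theorem heckeFactor_mul_heckeRow (t : ℕ → K) (p : ℕ) (z : K) (n b : ℕ) (c : K)
    (hc : t (b + 1) = c * t b) (hn : b + 2 ≤ n) :
    heckeFactor (b + p) c * heckeRow t p z n =
      heckeRow (t ∘ Equiv.swap b (b + 1)) p z n * heckeFactor (b + p + 1) c := by
  induction n, hn using Nat.le_induction with
  | base =>
    have h0 : heckeRow (t ∘ Equiv.swap b (b + 1)) p z b = heckeRow t p z b := by
      unfold heckeRow
      congr 1
      refine List.map_congr_left fun q hq => ?_
      have hq : q < b := by simpa using hq
      simp [Equiv.swap_apply_of_ne_of_ne (show q ≠ b by omega) (show q ≠ b + 1 by omega)]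
    have hyb := heckeFactor_yangBaxter (p + b) c (z * t b)
    have h1 := heckeRow_commute_high t p z b (i := b + p + 1) (by omega) c
    simp only [heckeRow_succ, h0, Function.comp_apply, Equiv.swap_apply_left,
      Equiv.swap_apply_right, hc]
    rw [mul_assoc (heckeFactor _ _) (_ * _), mul_assoc (heckeFactor _ _) (heckeRow _ _ _ _), h1.eq,
      add_comm b p, show z * (c * t b) = c * (z * t b) by ring]
    simp only [← mul_assoc] at hyb ⊢
    rw [show p + (b + 1) = p + b + 1 by omega, hyb]
  | succ n hn ih =>
    rw [heckeRow_succ, heckeRow_succ, ← mul_assoc,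
      (heckeFactor_commute (i := b + p) (j := p + n) (by omega) c _).eq, mul_assoc, ih,
      Function.comp_apply, Equiv.swap_apply_of_ne_of_ne (by omega) (by omega), mul_assoc]

/-- A factor moved across the whole grid from left to right exchanges the variables of two adjacent
columns and emerges on an antidiagonal beyond those of `S_d`. -/
theorem heckeFactor_mul_heckeGrid (u t : ℕ → K) (n m b : ℕ) (c : K)
    (hc : t (b + 1) = c * t b) (hn : b + 2 ≤ n) :
    heckeFactor b c * heckeGrid u t n m =
      heckeGrid u (t ∘ Equiv.swap b (b + 1)) n m * heckeFactor (b + m) c := by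
  induction m with
  | zero => simp [heckeGrid]
  | succ m ih =>
    rw [heckeGrid_succ, heckeGrid_succ, ← mul_assoc, ih, mul_assoc,
      heckeFactor_mul_heckeRow _ _ _ _ _ _ hc hn, mul_assoc]
    rfl

end YangBaxter

/-! ### Expansion into pipe dreams -/

section CellRun

variable {ι κ : Type*} [DecidableEq ι] [DecidableEq κ]

/-- The result of multiplying `π` on the right, in the Demazure product, by the letters `ltr c` of
the cells `c` of the list `L` that belong to `P`. -/
def cellRun (ltr : ι → ℕ) (P : Finset ι) (L : List ι) (π : Equiv.Perm ℕ) : Equiv.Perm ℕ :=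
  L.foldl (fun π c => if c ∈ P then demazureStep π (ltr c) else π) π

@[simp]
theorem cellRun_nil (ltr : ι → ℕ) (P : Finset ι) (π : Equiv.Perm ℕ) :
    cellRun ltr P [] π = π := rfl

theorem cellRun_cons (ltr : ι → ℕ) (P : Finset ι) (c : ι) (L : List ι) (π : Equiv.Perm ℕ) :
    cellRun ltr P (c :: L) π =
      cellRun ltr P L (if c ∈ P then demazureStep π (ltr c) else π) := rfl

theorem cellRun_append (ltr : ι → ℕ) (P : Finset ι) (L L' : List ι) (π : Equiv.Perm ℕ) :
    cellRun ltr P (L ++ L') π = cellRun ltr P L' (cellRun ltr P L π) :=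
  List.foldl_append

theorem cellRun_congr (ltr : ι → ℕ) {P Q : Finset ι} {L : List ι}
    (h : ∀ c ∈ L, c ∈ P ↔ c ∈ Q) (π : Equiv.Perm ℕ) : cellRun ltr P L π = cellRun ltr Q L π := by
  induction L generalizing π with
  | nil => rfl
  | cons c L ih =>
    rw [cellRun_cons, cellRun_cons, ih fun c' hc' => h c' (by simp [hc'])]
    simp only [h c (by simp)]

theorem cellRun_of_forall_notMem (ltr : ι → ℕ) {P : Finset ι} {L : List ι} (h : ∀ c ∈ L, c ∉ P)
    (π : Equiv.Perm ℕ) : cellRun ltr P L π = π := by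
  induction L generalizing π with
  | nil => rfl
  | cons c L ih =>
    rw [cellRun_cons, if_neg (h c (by simp)), ih fun c' hc' => h c' (by simp [hc'])]

theorem cellRun_map (ltr : κ → ℕ) (e : ι ↪ κ) (P : Finset ι) (L : List ι) (π : Equiv.Perm ℕ) :
    cellRun ltr (P.map e) (L.map e) π = cellRun (fun c => ltr (e c)) P L π := by
  induction L generalizing π with
  | nil => rfl
  | cons c L ih => simp [cellRun_cons, ih]

theorem foldl_demazureStep_filter (ltr : ι → ℕ) (P : Finset ι) (L : List ι) (π : Equiv.Perm ℕ) :
    ((L.filter (· ∈ P)).map ltr).foldl demazureStep π = cellRun ltr P L π := by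
  induction L generalizing π with
  | nil => rfl
  | cons c L ih =>
    rw [cellRun_cons]
    by_cases h : c ∈ P <;> simp [h, ih]

/-- Expanding the product of the factors of a list of cells gives a sum over sets of cells. -/
theorem prod_heckeFactor_apply {K : Type*} [CommRing K] (ltr : ι → ℕ) (w : ι → K) {L : List ι}
    (hL : L.Nodup) (F : Equiv.Perm ℕ → K) (π : Equiv.Perm ℕ) :
    (L.map fun c => heckeFactor (ltr c) (w c)).prod F π =
      ∑ P ∈ L.toFinset.powerset,
        (-1) ^ P.card * (∏ c ∈ P, (1 - w c)) * F (cellRun ltr P L π) := by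
  induction L generalizing π with
  | nil => simp
  | cons c L ih =>
    obtain ⟨hc, hL⟩ := List.nodup_cons.1 hL
    have hc' : c ∉ L.toFinset := by simpa using hc
    rw [List.map_cons, List.prod_cons, Module.End.mul_apply, heckeFactor_apply, ih hL, ih hL,
      List.toFinset_cons, Finset.sum_powerset_insert hc', sub_eq_add_neg, Finset.mul_sum,
      ← Finset.sum_neg_distrib]
    congr 1 <;> refine Finset.sum_congr rfl fun P hP => ?_
    · have hcP : c ∉ P := fun h => hc' (Finset.mem_powerset.1 hP h)
      rw [cellRun_cons, if_neg hcP]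
    · have hcP : c ∉ P := fun h => hc' (Finset.mem_powerset.1 hP h)
      rw [cellRun_cons, if_pos (Finset.mem_insert_self c P), Finset.card_insert_of_notMem hcP,
        Finset.prod_insert hcP, cellRun_congr ltr (P := insert c P) (Q := P)]
      · ring
      · intro c' h'
        rw [Finset.mem_insert, or_iff_right]
        rintro rfl
        exact hc h'

end CellRun

/-- The cells of the `d × d` grid in reading order. -/
def finCells (d : ℕ) : List (Fin d × Fin d) :=
  (List.finRange d).flatMap fun p => (List.finRange d).reverse.map fun q => (p, q)

theorem mem_finCells {d : ℕ} (c : Fin d × Fin d) : c ∈ finCells d := by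
  simp [finCells]

theorem nodup_finCells (d : ℕ) : (finCells d).Nodup := by
  unfold finCells
  refine List.nodup_flatMap.2 ⟨fun p _ => ?_, ?_⟩
  · exact (List.nodup_reverse.2 (List.nodup_finRange d)).map fun q q' h => (Prod.ext_iff.1 h).2
  · refine (List.nodup_finRange d).imp fun {p p'} hpp' => ?_
    rw [Function.onFun, List.disjoint_left]
    intro c hc hc'
    obtain ⟨q, -, rfl⟩ := List.mem_map.1 hc
    obtain ⟨q', -, h⟩ := List.mem_map.1 hc'
    exact hpp' (Prod.ext_iff.1 h).1.symm

theorem demazureProduct_eq_cellRun {d : ℕ} (P : PipeDream d) :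
    P.demazureProduct = cellRun (fun c => (c.1 : ℕ) + (c.2 : ℕ)) P (finCells d) 1 := by
  rw [← foldl_demazureStep_filter, PipeDream.demazureProduct, PipeDream.word]
  congr 1
  simp only [finCells, List.filter_flatMap, List.map_flatMap, List.filter_map, List.map_map,
    bind_pure_comp, List.map_eq_map]
  rfl

theorem toInfPerm_apply_lt {d : ℕ} (v : Equiv.Perm (Fin d)) (p : Fin d) :
    toInfPerm v p = v p :=
  Equiv.Perm.extendDomain_apply_image v Fin.equivSubtype p

theorem toInfPerm_apply_of_le {d : ℕ} (v : Equiv.Perm (Fin d)) {k : ℕ} (hk : d ≤ k) :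
    toInfPerm v k = k :=
  Equiv.Perm.extendDomain_apply_not_subtype v Fin.equivSubtype (not_lt.2 hk)

theorem toInfPerm_symm_apply_lt {d : ℕ} (v : Equiv.Perm (Fin d)) (p : Fin d) :
    (toInfPerm v).symm p = v.symm p := by
  rw [Equiv.symm_apply_eq, toInfPerm_apply_lt, Equiv.apply_symm_apply]

theorem toInfPerm_symm_apply_of_le {d : ℕ} (v : Equiv.Perm (Fin d)) {k : ℕ} (hk : d ≤ k) :
    (toInfPerm v).symm k = k := by
  rw [Equiv.symm_apply_eq, toInfPerm_apply_of_le v hk]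

theorem toInfPerm_mul_swap {d : ℕ} (v : Equiv.Perm (Fin d)) (a b : Fin d) :
    toInfPerm (v * Equiv.swap a b) = toInfPerm v * Equiv.swap (a : ℕ) (b : ℕ) := by
  ext k
  rcases lt_or_ge k d with hk | hk
  · lift k to Fin d using hk
    rw [toInfPerm_apply_lt, Equiv.Perm.mul_apply, Equiv.Perm.mul_apply,
      Fin.val_injective.swap_apply, toInfPerm_apply_lt]
  · rw [toInfPerm_apply_of_le _ hk, Equiv.Perm.mul_apply,
      Equiv.swap_apply_of_ne_of_ne (by omega) (by omega), toInfPerm_apply_of_le _ hk]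

/-- The signed sum of `∏ (1 - u_p t_q)` over the pipe dreams with Demazure product `v`. -/
noncomputable def pipeSum {d : ℕ} {K : Type*} [CommRing K] (v : Equiv.Perm (Fin d))
    (u t : Fin d → K) : K :=
  ∑ P ∈ pipeDreams v, (-1) ^ P.card * ∏ c ∈ P, (1 - u c.1 * t c.2)

section PipeSum

variable {d : ℕ} {K : Type*} [CommRing K]

theorem heckeGrid_eq_prod_finCells (u t : ℕ → K) :
    heckeGrid u t d d = ((finCells d).map fun c =>
      heckeFactor ((c.1 : ℕ) + (c.2 : ℕ)) (u c.1 * t c.2)).prod := by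
  simp only [heckeGrid, heckeRow, finCells, List.map_flatMap, List.map_map]
  simp only [List.flatMap_def, List.prod_flatten, ← List.map_coe_finRange_eq_range,
    List.map_reverse, List.map_map]
  rfl

/-- The sum over pipe dreams is a coefficient of the product of all factors of the grid. -/
theorem heckeGrid_single_apply_one [DecidableEq (Equiv.Perm ℕ)] (v : Equiv.Perm (Fin d))
    (u t : ℕ → K) :
    heckeGrid u t d d (Pi.single (toInfPerm v) 1) 1 =
      pipeSum v (fun p => u p) (fun q => t q) := by
  rw [heckeGrid_eq_prod_finCells, prod_heckeFactor_apply
    (fun c : Fin d × Fin d => (c.1 : ℕ) + (c.2 : ℕ)) (fun c => u c.1 * t c.2) (nodup_finCells d)]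
  have : (finCells d).toFinset = Finset.univ := by
    ext c
    simp [mem_finCells]
  rw [this, Finset.powerset_univ, pipeSum, pipeDreams, Finset.sum_filter]
  refine Finset.sum_congr rfl fun P _ => ?_
  rw [← demazureProduct_eq_cellRun, Pi.single_apply]
  split_ifs <;> simp

/-- Functions vanishing on the permutations in which the value `b + 1` precedes the value `b` form
a subspace stable under the 0-Hecke action, because inversions persist under it. -/
theorem heckeFactor_preserves_inversion {b : ℕ} {F : Equiv.Perm ℕ → K}
    (hF : ∀ π : Equiv.Perm ℕ, π.symm (b + 1) < π.symm b → F π = 0) (i : ℕ) (a : K)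
    (π : Equiv.Perm ℕ) (hπ : π.symm (b + 1) < π.symm b) : heckeFactor i a F π = 0 := by
  rw [heckeFactor_apply, hF π hπ, hF _ ?_]
  · simp
  · unfold demazureStep
    split_ifs with h
    · have h1 : (π * Equiv.swap i (i + 1)).symm = Equiv.swap i (i + 1) * π.symm := by
        ext; simp [Equiv.Perm.mul_def]
      rw [h1, Equiv.Perm.mul_apply, Equiv.Perm.mul_apply]
      have h2 : ¬ (π.symm (b + 1) = i ∧ π.symm b = i + 1) := by
        rintro ⟨h2, h3⟩
        rw [← h3, ← h2] at h
        simp at h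
      generalize π.symm (b + 1) = x at *
      generalize π.symm b = y at *
      simp only [Equiv.swap_apply_def]
      grind
    · exact hπ

theorem list_prod_preserves_inversion {b : ℕ} {F : Equiv.Perm ℕ → K}
    (hF : ∀ π : Equiv.Perm ℕ, π.symm (b + 1) < π.symm b → F π = 0)
    (L : List (ℕ × K)) (π : Equiv.Perm ℕ)
    (hπ : π.symm (b + 1) < π.symm b) :
    (L.map fun c => heckeFactor c.1 c.2).prod F π = 0 := by
  induction L generalizing π with
  | nil => exact hF π hπ
  | cons c L ih =>
    rw [List.map_cons, List.prod_cons, Module.End.mul_apply]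
    exact heckeFactor_preserves_inversion ih _ _ π hπ

/-- No pipe dream leads from `s_b` to a permutation in which `b` precedes `b + 1`. -/
theorem heckeGrid_single_apply_swap [DecidableEq (Equiv.Perm ℕ)] {σ : Equiv.Perm ℕ} {b : ℕ}
    (hσ : σ.symm b < σ.symm (b + 1)) (u t : ℕ → K) :
    heckeGrid u t d d (Pi.single σ 1) (demazureStep 1 b) = 0 := by
  have h := list_prod_preserves_inversion (K := K) (b := b) (F := Pi.single σ 1)
    (fun π hπ => Pi.single_eq_of_ne (by rintro rfl; exact lt_asymm hσ hπ) _)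
    ((finCells d).map fun c => ((c.1 : ℕ) + (c.2 : ℕ), u c.1 * t c.2)) (demazureStep 1 b)
    (by simp [demazureStep])
  rw [List.map_map] at h
  rw [heckeGrid_eq_prod_finCells]
  exact h

theorem demazureEnd_single_of_lt [DecidableEq (Equiv.Perm ℕ)] {σ : Equiv.Perm ℕ} {i : ℕ}
    (h : σ i < σ (i + 1)) : demazureEnd K i (Pi.single σ 1) = 0 := by
  ext π
  rw [demazureEnd_apply, Pi.single_eq_of_ne, Pi.zero_apply]
  rintro rfl
  simp only [demazureStep_apply] at h
  simp at h

theorem demazureEnd_single_of_gt [DecidableEq (Equiv.Perm ℕ)] {σ : Equiv.Perm ℕ} {i : ℕ}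
    (h : σ (i + 1) < σ i) :
    demazureEnd K i (Pi.single σ 1) =
      Pi.single σ 1 + Pi.single (σ * Equiv.swap i (i + 1)) 1 := by
  have hne : σ ≠ σ * Equiv.swap i (i + 1) := fun h' => by
    have := congrArg (fun τ : Equiv.Perm ℕ => τ i) h'
    simp at this
  ext π
  rw [demazureEnd_apply, Pi.add_apply, demazureStep]
  split_ifs with h1
  · have h2 : π ≠ σ := by rintro rfl; exact lt_asymm h h1
    rw [Pi.single_eq_of_ne h2, zero_add, Pi.single_apply, Pi.single_apply]
    congr 1
    rw [← eq_mul_inv_iff_mul_eq, Equiv.swap_inv]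
  · have h2 : π ≠ σ * Equiv.swap i (i + 1) := by rintro rfl; exact h1 (by simpa using h)
    rw [Pi.single_eq_of_ne h2, add_zero]

end PipeSum

section PipeSumField

variable {d : ℕ} {K : Type*} [Field K]

/-- Extension of a finite family by `1`. -/
def extendByOne (u : Fin d → K) (k : ℕ) : K := if h : k < d then u ⟨k, h⟩ else 1

theorem extendByOne_val (u : Fin d → K) (p : Fin d) : extendByOne u p = u p := by
  simp [extendByOne]

theorem extendByOne_swap (u : Fin d → K) (a b : Fin d) (p : Fin d) :
    (extendByOne u ∘ Equiv.swap (a : ℕ) (b : ℕ)) p = (u ∘ Equiv.swap a b) p := by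
  rw [Function.comp_apply, Fin.val_injective.swap_apply, extendByOne_val, Function.comp_apply]

/-- Exchanging two adjacent row variables amounts to applying a 0-Hecke operator to the
indicator function of `v`. -/
theorem pipeSum_comp_swap [DecidableEq (Equiv.Perm ℕ)] (v : Equiv.Perm (Fin d))
    (u t : Fin d → K) (a b : Fin d) (hab : (b : ℕ) = a + 1) (hu : u a ≠ 0) :
    pipeSum v (u ∘ Equiv.swap a b) t = pipeSum v u t - (1 - u b / u a) *
      heckeGrid (extendByOne u) (extendByOne t) d d
        (demazureEnd K a (Pi.single (toInfPerm v) 1)) 1 := by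
  have hc : extendByOne u ((a : ℕ) + 1) = extendByOne u a * (u b / u a) := by
    rw [← hab, extendByOne_val, extendByOne_val, mul_div_cancel₀ _ hu]
  have h := congrArg (fun f => f (Pi.single (toInfPerm v) 1) 1)
    (heckeGrid_mul_heckeFactor (extendByOne u) (extendByOne t) d d a (u b / u a) hc (by omega))
  simp only [Module.End.mul_apply] at h
  rw [heckeFactor_apply, heckeGrid_single_apply_swap (by
    rw [toInfPerm_symm_apply_of_le _ (by omega), toInfPerm_symm_apply_of_le _ (by omega)]
    omega), ← hab, heckeGrid_single_apply_one] at h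
  simp only [extendByOne_swap, extendByOne_val, mul_zero, sub_zero] at h
  change _ = pipeSum v (u ∘ Equiv.swap a b) t at h
  rw [← h, heckeFactor, LinearMap.sub_apply, LinearMap.smul_apply, map_sub, map_smul,
    Pi.sub_apply, Pi.smul_apply, Module.End.one_apply, heckeGrid_single_apply_one, smul_eq_mul]
  simp only [extendByOne_val]

/-- The sum over pipe dreams is symmetric in two adjacent row variables at an ascent. -/
theorem pipeSum_comp_swap_of_lt {v : Equiv.Perm (Fin d)} (u t : Fin d → K) {a b : Fin d}
    (hab : (b : ℕ) = a + 1) (hu : u a ≠ 0) (hv : v a < v b) :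
    pipeSum v (u ∘ Equiv.swap a b) t = pipeSum v u t := by
  classical
  rw [pipeSum_comp_swap v u t a b hab hu, demazureEnd_single_of_lt, map_zero]
  · simp
  · rwa [← hab, toInfPerm_apply_lt, toInfPerm_apply_lt, Fin.val_fin_lt]

/-- The Demazure recursion for the sums over pipe dreams, at a descent. -/
theorem pipeSum_comp_swap_of_gt {v : Equiv.Perm (Fin d)} (u t : Fin d → K) {a b : Fin d}
    (hab : (b : ℕ) = a + 1) (hu : u a ≠ 0) (hv : v b < v a) :
    pipeSum v (u ∘ Equiv.swap a b) t =
      pipeSum v u t - (1 - u b / u a) * (pipeSum v u t + pipeSum (v * Equiv.swap a b) u t) := by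
  classical
  rw [pipeSum_comp_swap v u t a b hab hu, demazureEnd_single_of_gt, map_add,
    Pi.add_apply, ← hab, ← toInfPerm_mul_swap, heckeGrid_single_apply_one,
    heckeGrid_single_apply_one]
  · simp only [extendByOne_val]
  · rwa [← hab, toInfPerm_apply_lt, toInfPerm_apply_lt, Fin.val_fin_lt]

/-- The sum over pipe dreams is symmetric in two adjacent column variables at an ascent of the
inverse permutation. -/
theorem pipeSum_comp_swap_col {v : Equiv.Perm (Fin d)} (u t : Fin d → K) {a b : Fin d}
    (hab : (b : ℕ) = a + 1) (ht : t a ≠ 0) (hv : v.symm a < v.symm b) :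
    pipeSum v u (t ∘ Equiv.swap a b) = pipeSum v u t := by
  classical
  have hc : extendByOne t ((a : ℕ) + 1) = (t b / t a) * extendByOne t a := by
    rw [← hab, extendByOne_val, extendByOne_val, div_mul_cancel₀ _ ht]
  have h := congrArg (fun f => f (Pi.single (toInfPerm v) 1) 1)
    (heckeFactor_mul_heckeGrid (extendByOne u) (extendByOne t) d d a (t b / t a) hc (by omega))
  simp only [Module.End.mul_apply] at h
  rw [heckeFactor_apply, heckeGrid_single_apply_swap (by
    rwa [← hab, toInfPerm_symm_apply_lt, toInfPerm_symm_apply_lt, Fin.val_fin_lt]),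
    heckeFactor, LinearMap.sub_apply, LinearMap.smul_apply, demazureEnd_single_of_lt (by
    rw [toInfPerm_apply_of_le _ (by omega), toInfPerm_apply_of_le _ (by omega)]
    omega), ← hab, smul_zero, sub_zero, Module.End.one_apply, heckeGrid_single_apply_one,
    heckeGrid_single_apply_one] at h
  simp only [extendByOne_swap, extendByOne_val, mul_zero, sub_zero] at h
  exact h.symm

end PipeSumField

/-! ### Row-by-row analysis of Demazure products -/

/-- The cells `(p, n - 1), …, (p, 0)`. -/
def rowCells (p n : ℕ) : List (ℕ × ℕ) := (List.range n).reverse.map fun q => (p, q)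

/-- The cells of the first `m` rows and `n` columns, in reading order. -/
def gridCells (n m : ℕ) : List (ℕ × ℕ) := (List.range m).flatMap fun p => rowCells p n

/-- The antidiagonal of a cell. -/
def cellLetter (c : ℕ × ℕ) : ℕ := c.1 + c.2

/-- The effect of the first `n` cells of row `p`. -/
def rowRun (P : Finset (ℕ × ℕ)) (p n : ℕ) (π : Equiv.Perm ℕ) : Equiv.Perm ℕ :=
  cellRun cellLetter P (rowCells p n) π

/-- The Demazure product of the part of `P` in the first `m` rows and `n` columns. -/
def gridRun (P : Finset (ℕ × ℕ)) (n m : ℕ) : Equiv.Perm ℕ :=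
  cellRun cellLetter P (gridCells n m) 1

section Runs

variable {P : Finset (ℕ × ℕ)}

@[simp]
theorem rowRun_zero (p : ℕ) (π : Equiv.Perm ℕ) : rowRun P p 0 π = π := rfl

theorem rowRun_succ (p n : ℕ) (π : Equiv.Perm ℕ) :
    rowRun P p (n + 1) π =
      rowRun P p n (if (p, n) ∈ P then demazureStep π (p + n) else π) := by
  simp [rowRun, rowCells, List.range_succ, cellRun_cons, cellLetter]

@[simp]
theorem gridRun_zero (n : ℕ) : gridRun P n 0 = 1 := rfl

theorem gridRun_succ (n m : ℕ) : gridRun P n (m + 1) = rowRun P m n (gridRun P n m) := by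
  simp [gridRun, rowRun, gridCells, List.range_succ, cellRun_append]

theorem rowRun_apply_of_lt (p n : ℕ) (π : Equiv.Perm ℕ) {k : ℕ} (hk : k < p) :
    rowRun P p n π k = π k := by
  induction n generalizing π with
  | zero => rfl
  | succ n ih =>
    rw [rowRun_succ, ih]
    split_ifs
    · rw [demazureStep_apply, if_neg (by omega), if_neg (by omega)]
    · rfl

/-- An entry is final once its row has been read. -/
theorem gridRun_apply_of_lt (n : ℕ) {m N k : ℕ} (hN : m ≤ N) (hk : k < m) :
    gridRun P n N k = gridRun P n m k := by
  induction N, hN using Nat.le_induction with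
  | base => rfl
  | succ N hN ih => rw [gridRun_succ, rowRun_apply_of_lt _ _ _ (by omega), ih]

theorem rowRun_apply_le (p j q : ℕ) (π : Equiv.Perm ℕ)
    (hπ : ∀ k, p ≤ k → k ≤ p + j → π k ≤ q) : rowRun P p j π p ≤ q := by
  induction j generalizing π with
  | zero => exact hπ p le_rfl (by omega)
  | succ j ih =>
    rw [rowRun_succ]
    refine ih _ fun k hk hk' => ?_
    have h0 := hπ k hk (by omega)
    have h1 := hπ (p + j) (by omega) (by omega)
    have h2 := hπ (p + j + 1) (by omega) (by omega)
    split_ifs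
    · rw [demazureStep_apply]
      grind
    · exact h0

/-- A value `> q` can be carried to the left end of its row through values `≤ q` only if all cells
on its way are crosses. -/
theorem mem_of_lt_rowRun_of_gap (p q j : ℕ) (π : Equiv.Perm ℕ) (hj : j ≤ q + 1)
    (hπ : ∀ k, π k ≤ q ↔ p ≤ k ∧ k ≤ p + q + 1 ∧ k ≠ p + j) (hq : q < rowRun P p j π p) :
    (∀ i < j, (p, i) ∈ P) ∧ ∀ k, rowRun P p j π k ≤ q ↔ p + 1 ≤ k ∧ k ≤ p + 1 + q := by
  induction j generalizing π with
  | zero =>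
    refine ⟨by simp, fun k => ?_⟩
    rw [rowRun_zero, hπ]
    omega
  | succ j ih =>
    rw [rowRun_succ] at hq ⊢
    have hc : (p, j) ∈ P := by
      by_contra hc
      rw [if_neg hc] at hq
      exact absurd hq (not_lt.2 (rowRun_apply_le p j q π fun k hk hk' =>
        (hπ k).2 ⟨hk, by omega, by omega⟩))
    rw [if_pos hc] at hq ⊢
    have hπ' : ∀ k, demazureStep π (p + j) k ≤ q ↔ p ≤ k ∧ k ≤ p + q + 1 ∧ k ≠ p + j := by
      intro k
      have h0 := hπ k
      have h1 := hπ (p + j)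
      have h2 := hπ (p + j + 1)
      rw [demazureStep_apply]
      grind
    obtain ⟨h1, h2⟩ := ih _ (by omega) hπ' hq
    refine ⟨fun i hi => ?_, h2⟩
    rcases Nat.lt_succ_iff_lt_or_eq.1 hi with hi | rfl
    exacts [h1 i hi, hc]

/-- If the values `≤ q` occupy the positions `p, …, p + q` and row `p` brings a value `> q` to the
position `p`, then the first `q + 1` cells of the row are crosses, and the row shifts the values
`≤ q` by one position. -/
theorem mem_of_lt_rowRun (p q n : ℕ) (π : Equiv.Perm ℕ) (hn : q + 1 ≤ n)
    (hπ : ∀ k, π k ≤ q ↔ p ≤ k ∧ k ≤ p + q) (hq : q < rowRun P p n π p) :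
    (∀ i ≤ q, (p, i) ∈ P) ∧ ∀ k, rowRun P p n π k ≤ q ↔ p + 1 ≤ k ∧ k ≤ p + 1 + q := by
  induction n, hn using Nat.le_induction generalizing π with
  | base =>
    rw [rowRun_succ] at hq ⊢
    have hc : (p, q) ∈ P := by
      by_contra hc
      rw [if_neg hc] at hq
      exact absurd hq (not_lt.2 (rowRun_apply_le p q q π fun k hk hk' => (hπ k).2 ⟨hk, hk'⟩))
    rw [if_pos hc] at hq ⊢
    have hπ' : ∀ k, demazureStep π (p + q) k ≤ q ↔ p ≤ k ∧ k ≤ p + q + 1 ∧ k ≠ p + q := by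
      intro k
      have h0 := hπ k
      have h1 := hπ (p + q)
      have h2 := hπ (p + q + 1)
      rw [demazureStep_apply]
      grind
    obtain ⟨h1, h2⟩ := mem_of_lt_rowRun_of_gap p q q _ (by omega) hπ' hq
    refine ⟨fun i hi => ?_, h2⟩
    rcases hi.lt_or_eq with hi | rfl
    exacts [h1 i hi, hc]
  | succ n hn ih =>
    rw [rowRun_succ] at hq ⊢
    refine ih _ (fun k => ?_) hq
    have h0 := hπ k
    have h1 := hπ (p + n)
    have h2 := hπ (p + n + 1)
    split_ifs
    · rw [demazureStep_apply]
      grind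
    · exact h0

/-- If the first `m` entries of the Demazure product exceed `q`, then all cells of the first `m`
rows and `q + 1` columns are crosses. -/
theorem mem_of_lt_gridRun (n q m : ℕ) (hq : q < n) (h : ∀ p < m, q < gridRun P n m p) :
    (∀ p < m, ∀ i ≤ q, (p, i) ∈ P) ∧ ∀ k, gridRun P n m k ≤ q ↔ m ≤ k ∧ k ≤ m + q := by
  induction m with
  | zero => simp
  | succ m ih =>
    obtain ⟨h1, h2⟩ := ih fun p hp => by
      rw [← gridRun_apply_of_lt n (Nat.le_succ m) hp]
      exact h p (by omega)
    have h3 := h m (by omega)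
    rw [gridRun_succ] at h3 ⊢
    obtain ⟨h4, h5⟩ := mem_of_lt_rowRun m q n _ hq h2 h3
    refine ⟨fun p hp i hi => ?_, h5⟩
    rcases Nat.lt_succ_iff_lt_or_eq.1 hp with hp | rfl
    exacts [h1 p hp i hi, h4 i hi]

/-- A full initial segment of a row acts as a cycle when the entry that it carries to the left
end is larger than the entries passed. -/
theorem rowRun_of_forall_mem (p j : ℕ) (π : Equiv.Perm ℕ) (hP : ∀ i < j, (p, i) ∈ P)
    (hπ : ∀ k, p ≤ k → k < p + j → π k < π (p + j)) :
    rowRun P p j π p = π (p + j) ∧ (∀ k, p ≤ k → k < p + j → rowRun P p j π (k + 1) = π k) ∧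
      ∀ k, k < p ∨ p + j < k → rowRun P p j π k = π k := by
  induction j generalizing π with
  | zero => simp
  | succ j ih =>
    rw [rowRun_succ, if_pos (hP j (by omega))]
    have hlt := hπ (p + j) (by omega) (by omega)
    have hs := demazureStep_apply π (p + j)
    generalize demazureStep π (p + j) = σ at hs
    have hσ : σ (p + j) = π (p + (j + 1)) := by rw [hs]; grind
    obtain ⟨h1, h2, h3⟩ := ih σ (fun i hi => hP i (by omega)) fun k hk hk' => by
      rw [hσ, hs, if_neg (by omega), if_neg (by omega)]
      exact hπ k hk (by omega)
    refine ⟨h1.trans hσ, fun k hk hk' => ?_, fun k hk => ?_⟩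
    · rcases (show k < p + j ∨ k = p + j by omega) with hk' | rfl
      · rw [h2 k hk hk', hs, if_neg (by omega), if_neg (by omega)]
      · rw [h3 _ (by omega), hs]
        grind
    · rw [h3 k (by omega), hs, if_neg (by omega), if_neg (by omega)]

theorem rowRun_eq_of_shape (p l n : ℕ) (π : Equiv.Perm ℕ) (hln : l ≤ n)
    (hP : ∀ i < n, (p, i) ∈ P ↔ i < l) : rowRun P p n π = rowRun P p l π := by
  induction n, hln using Nat.le_induction with
  | base => rfl
  | succ n hn ih =>
    rw [rowRun_succ, if_neg (by rw [hP n (by omega)]; omega), ih fun i hi => hP i (by omega)]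

/-- The partial Demazure products of a partition shape: after `m` rows the remaining entries are
increasing, the smallest ones `0, 1, …` come first, and the Rothe diagram of the entries already
placed is the shape itself. -/
structure ShapeState (l : ℕ → ℕ) (m : ℕ) (σ : Equiv.Perm ℕ) : Prop where
  strictMono : ∀ j k, m ≤ j → j < k → σ j < σ k
  apply_add : ∀ j < l m, σ (m + j) = j
  le_apply : ∀ p < m, l p ≤ σ p
  lt_of_apply_lt : ∀ p < m, ∀ k, p < k → σ k < σ p → σ k < l p

theorem shapeState_gridRun (l : ℕ → ℕ) (hl : Antitone l) (n m : ℕ) (hln : ∀ p < m, l p ≤ n)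
    (hP : ∀ p < m, ∀ i < n, (p, i) ∈ P ↔ i < l p) : ShapeState l m (gridRun P n m) := by
  induction m with
  | zero => exact ⟨fun j k _ h => h, fun j _ => by simp, by simp, by simp⟩
  | succ m ih =>
    obtain ⟨h1, h2, h3, h4⟩ := ih (fun p hp => hln p (by omega)) fun p hp => hP p (by omega)
    rw [gridRun_succ, rowRun_eq_of_shape m (l m) n _ (hln m (by omega)) (hP m (by omega))]
    obtain ⟨r1, r2, r3⟩ := rowRun_of_forall_mem (P := P) m (l m) (gridRun P n m)
      (fun i hi => (hP m (by omega) i (hi.trans_le (hln m (by omega)))).2 hi)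
      (fun k hk hk' => h1 k _ hk hk')
    generalize gridRun P n m = σ at *
    generalize rowRun P m (l m) σ = τ at *
    -- every entry beyond position `m` comes from some other position weakly beyond `m`
    have hpos : ∀ k, m < k → ∃ k', m ≤ k' ∧ k' ≠ m + l m ∧ τ k = σ k' := by
      intro k hk
      by_cases hk' : k ≤ m + l m
      · obtain ⟨k, rfl⟩ : ∃ k₀, k = k₀ + 1 := ⟨k - 1, by omega⟩
        exact ⟨k, by omega, by omega, r2 k (by omega) (by omega)⟩
      · exact ⟨k, by omega, by omega, r3 k (by omega)⟩
    refine ⟨fun j k hj hjk => ?_, fun j hj => ?_, fun p hp => ?_, fun p hp k hk hlt => ?_⟩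
    · by_cases hk : k ≤ m + l m
      · obtain ⟨j, rfl⟩ : ∃ j₀, j = j₀ + 1 := ⟨j - 1, by omega⟩
        obtain ⟨k, rfl⟩ : ∃ k₀, k = k₀ + 1 := ⟨k - 1, by omega⟩
        rw [r2 j (by omega) (by omega), r2 k (by omega) (by omega)]
        exact h1 _ _ (by omega) (by omega)
      · rw [r3 k (by omega)]
        by_cases hj' : j ≤ m + l m
        · obtain ⟨j, rfl⟩ : ∃ j₀, j = j₀ + 1 := ⟨j - 1, by omega⟩
          rw [r2 j (by omega) (by omega)]
          exact h1 _ _ (by omega) (by omega)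
        · rw [r3 j (by omega)]
          exact h1 _ _ (by omega) (by omega)
    · have hj' : j < l m := hj.trans_le (hl (Nat.le_succ m))
      rw [show m + 1 + j = m + j + 1 by omega, r2 _ (by omega) (by omega), h2 j hj']
    · rcases Nat.lt_succ_iff_lt_or_eq.1 hp with hp | rfl
      · rw [r3 p (by omega)]
        exact h3 p hp
      · rw [r1]
        rcases Nat.eq_zero_or_pos (l p) with h0 | h0
        · omega
        · have := h1 (p + (l p - 1)) (p + l p) (by omega) (by omega)
          rw [h2 _ (by omega)] at this
          omega
    · rcases Nat.lt_succ_iff_lt_or_eq.1 hp with hp | rfl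
      · rw [r3 p (by omega)] at hlt
        rcases lt_trichotomy k m with hkm | rfl | hkm
        · rw [r3 k (by omega)] at hlt ⊢
          exact h4 p hp k hk hlt
        · rw [r1] at hlt ⊢
          exact h4 p hp _ (by omega) hlt
        · obtain ⟨k', hk', -, hτ⟩ := hpos k hkm
          rw [hτ] at hlt ⊢
          exact h4 p hp k' (by omega) hlt
      · obtain ⟨k', hk', hne, hτ⟩ := hpos k hk
        rw [hτ, r1] at hlt
        have hk'' : k' < p + l p := by
          by_contra hcon
          exact lt_asymm hlt (h1 _ _ (by omega) (by omega))
        obtain ⟨j, rfl⟩ := Nat.exists_eq_add_of_le hk'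
        rw [hτ, h2 j (by omega)]
        omega

theorem gridRun_apply_of_ge (l : ℕ → ℕ) (d n m : ℕ) (hl : Antitone l)
    (hln : ∀ p < m, l p ≤ n) (hld : ∀ p < m, p + l p < d)
    (hP : ∀ p < m, ∀ i < n, (p, i) ∈ P ↔ i < l p) {k : ℕ} (hk : d ≤ k) :
    gridRun P n m k = k := by
  induction m with
  | zero => rfl
  | succ m ih =>
    have hS := shapeState_gridRun l hl n m (fun p hp => hln p (by omega))
      fun p hp => hP p (by omega)
    have := hld m (by omega)
    rw [gridRun_succ, rowRun_eq_of_shape m (l m) n _ (hln m (by omega)) (hP m (by omega)),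
      (rowRun_of_forall_mem (P := P) m (l m) (gridRun P n m)
      (fun i hi => (hP m (by omega) i (hi.trans_le (hln m (by omega)))).2 hi)
      (fun k hk hk' => hS.strictMono k _ hk hk')).2.2 k (by omega)]
    exact ih (fun p hp => hln p (by omega)) (fun p hp => hld p (by omega))
      fun p hp => hP p (by omega)

/-- Reading a partition shape, every cell outside the shape is met at an ascent. -/
theorem cellRun_ascent_of_shape (l : ℕ → ℕ) (hl : Antitone l) (n m : ℕ) (hln : ∀ p < m, l p ≤ n)
    (hP : ∀ p < m, ∀ i < n, (p, i) ∈ P ↔ i < l p) {A B : List (ℕ × ℕ)} {c : ℕ × ℕ}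
    (h : gridCells n m = A ++ c :: B) (hc : c ∉ P) :
    cellRun cellLetter P A 1 (cellLetter c) < cellRun cellLetter P A 1 (cellLetter c + 1) := by
  induction m generalizing A B with
  | zero => simp [gridCells] at h
  | succ m ih =>
    have hS := shapeState_gridRun l hl n m (fun p hp => hln p (by omega))
      fun p hp => hP p (by omega)
    replace ih := @ih (fun p hp => hln p (by omega)) fun p hp => hP p (by omega)
    have hg : gridCells n (m + 1) = gridCells n m ++ rowCells m n := by
      simp [gridCells, List.range_succ]
    rw [hg, List.append_eq_append_iff] at h
    have key : ∀ A', rowCells m n = A' ++ c :: B →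
        cellRun cellLetter P (gridCells n m ++ A') 1 (cellLetter c) <
          cellRun cellLetter P (gridCells n m ++ A') 1 (cellLetter c + 1) := by
      intro A' h
      have hcm : c ∈ rowCells m n := by simp [h]
      obtain ⟨q, hq, rfl⟩ := List.mem_map.1 hcm
      have hq : q < n := by simpa using hq
      have hpw : (rowCells m n).Pairwise fun c c' => c'.2 < c.2 := by
        rw [rowCells, List.pairwise_map, List.pairwise_reverse]
        exact List.pairwise_lt_range
      rw [cellRun_append, cellRun_of_forall_notMem]
      · exact hS.strictMono _ _ (by simp [cellLetter]) (by omega)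
      · intro c' hc'
        have hc'm : c' ∈ rowCells m n := by simp [h, hc']
        obtain ⟨q', hq', rfl⟩ := List.mem_map.1 hc'm
        have hq' : q' < n := by simpa using hq'
        rw [h, List.pairwise_append] at hpw
        have hlt : q < q' := hpw.2.2 _ hc' (m, q) (by simp)
        rw [hP m (by omega) q hq] at hc
        rw [hP m (by omega) q' hq']
        omega
    rcases h with ⟨A', rfl, h⟩ | ⟨A', h, h'⟩
    · exact key A' h
    · rcases A' with _ | ⟨c', A'⟩
      · rw [List.append_nil] at h
        rw [← h]
        simpa using key [] h'.symm
      · rw [List.cons_append, List.cons.injEq] at h'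
        rw [← h'.1] at h
        exact ih h

end Runs

/-! ### Dominant permutations -/

/-- The inclusion of the cells of the `d × d` grid into `ℕ × ℕ`. -/
def cellEmb (d : ℕ) : Fin d × Fin d ↪ ℕ × ℕ :=
  Fin.valEmbedding.prodMap Fin.valEmbedding

theorem map_cellEmb_finCells (d : ℕ) : (finCells d).map (cellEmb d) = gridCells d d := by
  simp only [gridCells, rowCells, finCells, List.map_flatMap, List.map_map]
  simp only [List.flatMap_def, ← List.map_coe_finRange_eq_range, List.map_reverse, List.map_map]
  rfl

theorem cellRun_eq_cellRun_map {d : ℕ} (P : PipeDream d) (L : List (Fin d × Fin d))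
    (π : Equiv.Perm ℕ) :
    cellRun (fun c => (c.1 : ℕ) + (c.2 : ℕ)) P L π =
      cellRun cellLetter (P.map (cellEmb d)) (L.map (cellEmb d)) π :=
  (cellRun_map cellLetter (cellEmb d) P L π).symm

theorem demazureProduct_eq_gridRun {d : ℕ} (P : PipeDream d) :
    P.demazureProduct = gridRun (P.map (cellEmb d)) d d := by
  rw [demazureProduct_eq_cellRun, cellRun_eq_cellRun_map, map_cellEmb_finCells, gridRun]

theorem mem_map_cellEmb {d : ℕ} (P : PipeDream d) (p q : Fin d) :
    ((p : ℕ), (q : ℕ)) ∈ P.map (cellEmb d) ↔ (p, q) ∈ P :=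
  Finset.mem_map' (cellEmb d) (a := (p, q))

theorem mem_pipeDreams {d : ℕ} {v : Equiv.Perm (Fin d)} {P : PipeDream d} :
    P ∈ pipeDreams v ↔ P.demazureProduct = toInfPerm v := by
  simp [pipeDreams]

/-- A pipe dream for `v` contains every northwest rectangle that contains no ones of `v`. -/
theorem mem_of_mem_pipeDreams {d : ℕ} {v : Equiv.Perm (Fin d)} {P : PipeDream d}
    (hP : P ∈ pipeDreams v) {p q : Fin d} (h : ∀ p' ≤ p, q < v p') : (p, q) ∈ P := by
  rw [mem_pipeDreams, demazureProduct_eq_gridRun] at hP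
  rw [← mem_map_cellEmb]
  refine (mem_of_lt_gridRun d q (p + 1) q.2 fun p' hp' => ?_).1 p (by omega) q le_rfl
  rw [← gridRun_apply_of_lt d (N := d) (by omega) hp', hP]
  lift p' to Fin d using (by omega)
  rw [toInfPerm_apply_lt]
  exact h p' (Fin.le_def.2 (by omega))

theorem exists_toInfPerm_eq {d : ℕ} (σ : Equiv.Perm ℕ) (hσ : ∀ k, d ≤ k → σ k = k) :
    ∃ v : Equiv.Perm (Fin d), toInfPerm v = σ := by
  have hlt : ∀ k, k < d → σ k < d := by
    intro k hk
    by_contra h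
    have := σ.injective (hσ (σ k) (by omega))
    omega
  let f : Fin d → Fin d := fun p => ⟨σ p, hlt p p.2⟩
  have hf : Function.Injective f := fun p p' h =>
    Fin.ext (σ.injective (congrArg Fin.val h))
  refine ⟨Equiv.ofBijective f (Finite.injective_iff_bijective.1 hf), ?_⟩
  ext k
  rcases lt_or_ge k d with hk | hk
  · lift k to Fin d using hk
    rw [toInfPerm_apply_lt]
    rfl
  · rw [toInfPerm_apply_of_le _ hk, hσ k hk]

/-- `v` is the dominant permutation of the shape `L`: a partition shape in the northwest corner,
strictly above the main antidiagonal, that contains no ones of `v` and contains the whole Rothe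
diagram of `v` (hence equals it). -/
structure IsDominantFor {d : ℕ} (v : Equiv.Perm (Fin d)) (L : PipeDream d) : Prop where
  mem_of_le : ∀ {p q p' q'}, (p, q) ∈ L → p' ≤ p → q' ≤ q → (p', q') ∈ L
  add_lt : ∀ {p q}, (p, q) ∈ L → (p : ℕ) + q + 1 < d
  notMem : ∀ p, (p, v p) ∉ L
  mem_of_inversion : ∀ {p p'}, p < p' → v p' < v p → (p, v p') ∈ L

namespace IsDominantFor

variable {d : ℕ} {v w : Equiv.Perm (Fin d)} {L : PipeDream d}

theorem lt_apply (hv : IsDominantFor v L) {p q : Fin d} (hpq : (p, q) ∈ L) : q < v p := by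
  by_contra h
  exact hv.notMem p (hv.mem_of_le hpq le_rfl (not_lt.1 h))

theorem eq (hv : IsDominantFor v L) (hw : IsDominantFor w L) : v = w := by
  -- where `v` first differs from `w`, the smaller of the two values gives a cell of `L`
  have key : ∀ {v w : Equiv.Perm (Fin d)}, IsDominantFor v L → IsDominantFor w L → ∀ p,
      (∀ p' < p, v p' = w p') → ¬ v p < w p := by
    intro v w hv hw p ih h
    have h1 : p < w.symm (v p) := by
      by_contra h1
      rcases (not_lt.1 h1).lt_or_eq with h1 | h1
      · have := ih _ h1
        rw [Equiv.apply_symm_apply] at this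
        exact h1.ne (v.injective this)
      · have := congrArg w h1
        rw [Equiv.apply_symm_apply] at this
        exact h.ne this
    have h2 := hw.mem_of_inversion h1 (by simpa using h)
    rw [Equiv.apply_symm_apply] at h2
    exact hv.notMem p h2
  ext p
  induction p using WellFoundedLT.induction with
  | ind p ih =>
    have ih' : ∀ p' < p, v p' = w p' := fun p' hp' => Fin.ext (ih p' hp')
    exact congrArg Fin.val (le_antisymm (not_lt.1 (key hw hv p fun p' hp' => (ih' p' hp').symm))
      (not_lt.1 (key hv hw p ih')))

theorem permLength_eq_card (hv : IsDominantFor v L) : permLength v = L.card := by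
  refine Finset.card_bij (fun c _ => (c.1, v c.2)) ?_ ?_ ?_
  · intro c hc
    simp only [Finset.mem_filter, Finset.mem_univ, true_and] at hc
    exact hv.mem_of_inversion hc.1 hc.2
  · rintro ⟨a, b⟩ - ⟨a', b'⟩ - h
    simp_all
  · rintro ⟨p, q⟩ hpq
    refine ⟨(p, v.symm q), ?_, by simp⟩
    simp only [Finset.mem_filter, Finset.mem_univ, true_and, Equiv.apply_symm_apply]
    refine ⟨?_, hv.lt_apply hpq⟩
    by_contra h
    exact hv.notMem (v.symm q) (hv.mem_of_le hpq (not_lt.1 h) (by simp))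

end IsDominantFor

/-- The row lengths of a set of cells. -/
def rowLength {d : ℕ} (L : PipeDream d) (p : ℕ) : ℕ :=
  ((Finset.univ : Finset (Fin d)).filter fun q => ∃ p' : Fin d, (p' : ℕ) = p ∧ (p', q) ∈ L).card

theorem mem_iff_lt_rowLength {d : ℕ} {L : PipeDream d}
    (hL : ∀ {p q p' q' : Fin d}, (p, q) ∈ L → p' ≤ p → q' ≤ q → (p', q') ∈ L)
    (p q : Fin d) : (p, q) ∈ L ↔ (q : ℕ) < rowLength L p := by
  have h0 : rowLength L p = ((Finset.univ : Finset (Fin d)).filter fun q => (p, q) ∈ L).card := by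
    unfold rowLength
    congr 1
    ext q
    simp only [Finset.mem_filter, Finset.mem_univ, true_and, Fin.val_inj, exists_eq_left]
  rw [h0]
  constructor
  · intro h
    have h1 : Finset.Iic q ⊆ (Finset.univ : Finset (Fin d)).filter fun q => (p, q) ∈ L := by
      intro q' hq'
      simpa using hL h le_rfl (Finset.mem_Iic.1 hq')
    have := Finset.card_le_card h1
    rw [Fin.card_Iic] at this
    omega
  · intro h
    by_contra hq
    have h1 : (Finset.univ : Finset (Fin d)).filter (fun q => (p, q) ∈ L) ⊆ Finset.Iio q := by
      intro q' hq'
      simp only [Finset.mem_filter, Finset.mem_univ, true_and] at hq'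
      rw [Finset.mem_Iio]
      by_contra hlt
      exact hq (hL hq' le_rfl (not_lt.1 hlt))
    have := Finset.card_le_card h1
    rw [Fin.card_Iio] at this
    omega

theorem antitone_rowLength {d : ℕ} {L : PipeDream d}
    (hL : ∀ {p q p' q' : Fin d}, (p, q) ∈ L → p' ≤ p → q' ≤ q → (p', q') ∈ L) :
    Antitone (rowLength L) := by
  intro p p' hpp'
  refine Finset.card_le_card fun q hq => ?_
  simp only [Finset.mem_filter, Finset.mem_univ, true_and] at hq ⊢
  obtain ⟨r, rfl, hr⟩ := hq
  exact ⟨⟨p, by omega⟩, rfl, hL hr hpp' le_rfl⟩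

theorem rowLength_le {d : ℕ} (L : PipeDream d) (p : ℕ) : rowLength L p ≤ d := by
  exact (Finset.card_filter_le _ _).trans_eq (Finset.card_fin d)

theorem mem_map_cellEmb_iff_lt_rowLength {d : ℕ} {L : PipeDream d}
    (hL : ∀ {p q p' q' : Fin d}, (p, q) ∈ L → p' ≤ p → q' ≤ q → (p', q') ∈ L) {p q : ℕ}
    (hp : p < d) (hq : q < d) : (p, q) ∈ L.map (cellEmb d) ↔ q < rowLength L p := by
  lift p to Fin d using hp
  lift q to Fin d using hq
  rw [mem_map_cellEmb, mem_iff_lt_rowLength hL]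

/-- A partition shape above the antidiagonal is a pipe dream for a dominant permutation. -/
theorem exists_isDominantFor {d : ℕ} {L : PipeDream d}
    (hL : ∀ {p q p' q' : Fin d}, (p, q) ∈ L → p' ≤ p → q' ≤ q → (p', q') ∈ L)
    (hd : ∀ {p q : Fin d}, (p, q) ∈ L → (p : ℕ) + q + 1 < d) :
    ∃ v : Equiv.Perm (Fin d), IsDominantFor v L ∧ L ∈ pipeDreams v := by
  have hP : ∀ p < d, ∀ i < d, (p, i) ∈ L.map (cellEmb d) ↔ i < rowLength L p :=
    fun p hp i hi => mem_map_cellEmb_iff_lt_rowLength hL hp hi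
  have hS := shapeState_gridRun (rowLength L) (antitone_rowLength hL) d d
    (fun p _ => rowLength_le L p) hP
  obtain ⟨v, hv⟩ := exists_toInfPerm_eq (d := d) (gridRun (L.map (cellEmb d)) d d) fun k hk => by
    refine gridRun_apply_of_ge (rowLength L) d d d (antitone_rowLength hL)
      (fun p _ => rowLength_le L p) (fun p hp => ?_) hP hk
    rcases Nat.eq_zero_or_pos (rowLength L p) with h0 | h0
    · omega
    · have hle := rowLength_le L p
      have := hd ((mem_iff_lt_rowLength hL ⟨p, hp⟩ ⟨rowLength L p - 1, by omega⟩).2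
        (by simp only; omega))
      simp only at this
      omega
  rw [← hv] at hS
  refine ⟨v, ⟨hL, hd, fun p => ?_, fun {p p'} hpp' hlt => ?_⟩, ?_⟩
  · rw [mem_iff_lt_rowLength hL, not_lt, ← toInfPerm_apply_lt]
    exact hS.le_apply p p.2
  · rw [mem_iff_lt_rowLength hL, ← toInfPerm_apply_lt]
    refine hS.lt_of_apply_lt p p.2 p' hpp' ?_
    rwa [toInfPerm_apply_lt, toInfPerm_apply_lt]
  · rw [mem_pipeDreams, demazureProduct_eq_gridRun, hv]

section Deletion

variable {ι : Type*} [DecidableEq ι]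

theorem cellRun_erase (ltr : ι → ℕ) (P : Finset ι) {A B : List ι} {e : ι}
    (hL : (A ++ e :: B).Nodup) (π : Equiv.Perm ℕ)
    (he : ¬ cellRun ltr P A π (ltr e) < cellRun ltr P A π (ltr e + 1)) :
    cellRun ltr (P.erase e) (A ++ e :: B) π = cellRun ltr P (A ++ e :: B) π := by
  have hA : e ∉ A := fun h => List.disjoint_of_nodup_append hL h (by simp)
  have hB : e ∉ B := (List.nodup_cons.1 hL.of_append_right).1
  have hAr : cellRun ltr (P.erase e) A π = cellRun ltr P A π :=
    cellRun_congr ltr (fun c hc => by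
      rw [Finset.mem_erase, and_iff_right]; rintro rfl; exact hA hc) π
  have hBr : ∀ π, cellRun ltr (P.erase e) B π = cellRun ltr P B π :=
    cellRun_congr ltr (fun c hc => by
      rw [Finset.mem_erase, and_iff_right]; rintro rfl; exact hB hc)
  have hstep : demazureStep (cellRun ltr P A π) (ltr e) = cellRun ltr P A π := if_neg he
  rw [cellRun_append, cellRun_append, cellRun_cons, cellRun_cons, hAr, hBr, hstep]
  simp

/-- If no letter is omitted in a Demazure product, it is the product in the group. -/
theorem cellRun_eq_mul_prod (ltr : ι → ℕ) (P : Finset ι) (B : List ι) (π : Equiv.Perm ℕ)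
    (h : ∀ B₁ e B₂, B = B₁ ++ e :: B₂ → e ∈ P →
      cellRun ltr P B₁ π (ltr e) < cellRun ltr P B₁ π (ltr e + 1)) :
    cellRun ltr P B π =
      π * ((B.filter (· ∈ P)).map fun c => Equiv.swap (ltr c) (ltr c + 1)).prod := by
  induction B generalizing π with
  | nil => simp
  | cons c B ih =>
    rw [cellRun_cons, ih]
    · by_cases hc : c ∈ P
      · have := h [] c B rfl hc
        rw [cellRun_nil] at this
        simp [hc, demazureStep, this, mul_assoc]
      · simp [hc]
    · intro B₁ e B₂ hB he
      exact h (c :: B₁) e B₂ (by rw [hB]; rfl) he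

end Deletion

/-- A list can be split at its last element with a given property. -/
theorem exists_eq_append_cons_of_exists {ι : Type*} {p : ι → Prop} {L : List ι} (h : ∃ c ∈ L, p c) :
    ∃ A c B, L = A ++ c :: B ∧ p c ∧ ∀ b ∈ B, ¬ p b := by
  induction L with
  | nil => simp at h
  | cons c L ih =>
    by_cases hL : ∃ c ∈ L, p c
    · obtain ⟨A, c', B, rfl, h1, h2⟩ := ih hL
      exact ⟨c :: A, c', B, rfl, h1, h2⟩
    · push Not at hL
      obtain ⟨c', hc', hp⟩ := h
      rcases List.mem_cons.1 hc' with rfl | hc'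
      · exact ⟨[], c', L, rfl, hp, hL⟩
      · exact absurd hp (hL c' hc')

/-- A dominant permutation has exactly one pipe dream, reduced or not, namely its shape. Every
pipe dream `P` for it contains the shape `L`, so no cross in `L` can be deleted, that is, all
crosses in `L` increase the length. If `c` is the last cross of `P` outside `L`, cancelling the
letters after `c` shows that the permutation reached right after `c` is the one reached by `L`
before `c`; but the former has a descent and the latter an ascent at the letter of `c`. -/
theorem IsDominantFor.pipeDreams_eq {d : ℕ} {v : Equiv.Perm (Fin d)} {L : PipeDream d}
    (hv : IsDominantFor v L) : pipeDreams v = {L} := by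
  have hLv : L ∈ pipeDreams v := by
    obtain ⟨w, hw, hLw⟩ := exists_isDominantFor hv.mem_of_le hv.add_lt
    rwa [hv.eq hw]
  have hsub : ∀ P ∈ pipeDreams v, L ⊆ P := by
    rintro P hP ⟨p, q⟩ hpq
    exact mem_of_mem_pipeDreams hP fun p' hp' => hv.lt_apply (hv.mem_of_le hpq hp' le_rfl)
  refine Finset.eq_singleton_iff_unique_mem.2 ⟨hLv, fun P hP => ?_⟩
  by_contra hne
  have hex : ∃ c ∈ finCells d, c ∈ P ∧ c ∉ L := by
    by_contra hcon
    push Not at hcon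
    exact hne (Finset.Subset.antisymm (fun c hc => hcon c (mem_finCells c) hc) (hsub P hP))
  obtain ⟨A, c, B, hsplit, ⟨hcP, hcL⟩, hB⟩ := exists_eq_append_cons_of_exists hex
  have htight : ∀ Q ∈ pipeDreams v, ∀ A e B, finCells d = A ++ e :: B → e ∈ L →
      cellRun (fun c => (c.1 : ℕ) + (c.2 : ℕ)) Q A 1 ((e.1 : ℕ) + e.2) <
        cellRun (fun c => (c.1 : ℕ) + (c.2 : ℕ)) Q A 1 ((e.1 : ℕ) + e.2 + 1) := by
    intro Q hQ A e B hs he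
    by_contra hcon
    have h1 := cellRun_erase (fun c : Fin d × Fin d => (c.1 : ℕ) + (c.2 : ℕ)) Q
      (hs ▸ nodup_finCells d) 1 hcon
    rw [← hs, ← demazureProduct_eq_cellRun, ← demazureProduct_eq_cellRun] at h1
    have h2 := hsub (Q.erase e) (mem_pipeDreams.2 (h1.trans (mem_pipeDreams.1 hQ))) he
    exact Finset.notMem_erase e Q h2
  have hprod : ∀ Q ∈ pipeDreams v, (∀ b ∈ B, b ∈ Q ↔ b ∈ L) →
      toInfPerm v = cellRun (fun c => (c.1 : ℕ) + (c.2 : ℕ)) Q (A ++ [c]) 1 *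
        ((B.filter (· ∈ L)).map fun c : Fin d × Fin d =>
          Equiv.swap ((c.1 : ℕ) + c.2) ((c.1 : ℕ) + c.2 + 1)).prod := by
    intro Q hQ hQL
    have hf : B.filter (· ∈ L) = B.filter (· ∈ Q) :=
      List.filter_congr fun b hb => by simp [hQL b hb]
    rw [hf, ← cellRun_eq_mul_prod (fun c : Fin d × Fin d => (c.1 : ℕ) + (c.2 : ℕ)),
      ← cellRun_append, ← mem_pipeDreams.1 hQ, demazureProduct_eq_cellRun, hsplit,
      List.append_assoc, List.singleton_append]
    intro B₁ e B₂ hBe he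
    rw [← cellRun_append]
    refine htight Q hQ _ e B₂ ?_ ((hQL e (by simp [hBe])).1 he)
    rw [hsplit, hBe]
    simp
  have h1 := hprod P hP fun b hb => ⟨fun h => by_contra fun h' => hB b hb ⟨h, h'⟩,
    fun h => hsub P hP h⟩
  have h2 := hprod L hLv fun b _ => Iff.rfl
  have h3 := mul_right_cancel (h1.symm.trans h2)
  rw [cellRun_append, cellRun_append, cellRun_cons, cellRun_cons, if_pos hcP, if_neg hcL,
    cellRun_nil, cellRun_nil] at h3
  have hasc := cellRun_ascent_of_shape (rowLength L) (antitone_rowLength hv.mem_of_le) d d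
    (fun p _ => rowLength_le L p)
    (fun p hp i hi => mem_map_cellEmb_iff_lt_rowLength hv.mem_of_le hp hi)
    (A := A.map (cellEmb d)) (B := B.map (cellEmb d)) (c := cellEmb d c)
    (by rw [← map_cellEmb_finCells, hsplit]; simp) (by simpa using hcL)
  rw [← cellRun_eq_cellRun_map, ← h3, demazureStep_apply, demazureStep_apply] at hasc
  change (if (c.1 : ℕ) + (c.2 : ℕ) = (c.1 : ℕ) + (c.2 : ℕ) then _ else _) <
    (if (c.1 : ℕ) + (c.2 : ℕ) + 1 = (c.1 : ℕ) + (c.2 : ℕ) then _ else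
      if (c.1 : ℕ) + (c.2 : ℕ) + 1 = (c.1 : ℕ) + (c.2 : ℕ) + 1 then _ else _) at hasc
  rw [if_pos rfl, if_neg (by omega), if_pos rfl] at hasc
  simp at hasc

/-- The sign of a permutation is the parity of its number of inversions. -/
theorem sign_eq_neg_one_pow_permLength {d : ℕ} (v : Equiv.Perm (Fin d)) :
    Equiv.Perm.sign v = (-1) ^ permLength v := by
  have h : Equiv.Perm.signAux v = Equiv.Perm.sign v := by
    induction v using Equiv.Perm.swap_induction_on with
    | one => simp [Equiv.Perm.signAux_one]
    | swap_mul f x y hxy ih =>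
      rw [Equiv.Perm.signAux_mul, Equiv.Perm.signAux_swap hxy, map_mul,
        Equiv.Perm.sign_swap hxy, ih]
  rw [← h, Equiv.Perm.signAux, Finset.prod_ite, Finset.prod_const_one, mul_one,
    Finset.prod_const, permLength]
  congr 1
  refine Finset.card_bij (fun a _ => (a.2, a.1)) ?_ ?_ ?_
  · rintro ⟨a, b⟩ h
    simp only [Finset.mem_filter, Equiv.Perm.mem_finPairsLT, Finset.mem_univ, true_and] at h ⊢
    exact ⟨h.1, lt_of_le_of_ne h.2 fun h' => h.1.ne' (v.injective h')⟩
  · rintro ⟨a, b⟩ - ⟨a', b'⟩ - h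
    simp_all
  · rintro ⟨a, b⟩ h
    simp only [Finset.mem_filter, Finset.mem_univ, true_and] at h
    exact ⟨⟨b, a⟩, by simp [Equiv.Perm.mem_finPairsLT, h.1, h.2.le], rfl⟩

/-! ### The pipe dream formula for double Grothendieck polynomials -/

section RatFun

variable {d : ℕ}

theorem zVar_ne_zero (p : Fin d) : (zVar p : RatFun d) ≠ 0 := by
  rw [zVar, map_ne_zero_iff _ (IsFractionRing.injective (MvPolynomial (Fin d ⊕ Fin d) ℤ) (RatFun d))]
  exact MvPolynomial.X_ne_zero _

theorem zDot_ne_zero (q : Fin d) : (zDot q : RatFun d) ≠ 0 := by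
  rw [zDot, map_ne_zero_iff _ (IsFractionRing.injective (MvPolynomial (Fin d ⊕ Fin d) ℤ) (RatFun d))]
  exact MvPolynomial.X_ne_zero _

theorem zVar_ne_zDot (p q : Fin d) : (zVar p : RatFun d) ≠ zDot q := by
  rw [zVar, zDot,
    (IsFractionRing.injective (MvPolynomial (Fin d ⊕ Fin d) ℤ) (RatFun d)).ne_iff,
    MvPolynomial.X_injective.ne_iff]
  simp

theorem zVar_injective : Function.Injective (zVar : Fin d → RatFun d) := by
  intro p q h
  exact Sum.inl_injective (MvPolynomial.X_injective
    (IsFractionRing.injective (MvPolynomial (Fin d ⊕ Fin d) ℤ) (RatFun d) h))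

theorem swapZ_zVar (a b p : Fin d) : swapZ a b (zVar p) = zVar (Equiv.swap a b p) := by
  rw [swapZ, zVar, IsFractionRing.ringEquivOfRingEquiv_algebraMap, zVar,
    ← Sum.inl_injective.swap_apply]
  simp

theorem swapZ_zDot (a b q : Fin d) : swapZ a b (zDot q) = zDot q := by
  rw [swapZ, zDot, IsFractionRing.ringEquivOfRingEquiv_algebraMap]
  simp [Equiv.swap_apply_of_ne_of_ne]

theorem map_pipeSum {K K' : Type*} [CommRing K] [CommRing K'] (φ : K →+* K')
    (v : Equiv.Perm (Fin d)) (u t : Fin d → K) :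
    φ (pipeSum v u t) = pipeSum v (φ ∘ u) (φ ∘ t) := by
  simp [pipeSum]

theorem isDominantFor_revPerm :
    IsDominantFor (Fin.revPerm : Equiv.Perm (Fin d))
      ((Finset.univ : Finset (Fin d × Fin d)).filter
        fun c => ((c.1 : ℕ) + 1) + ((c.2 : ℕ) + 1) ≤ d) := by
  refine ⟨?_, ?_, ?_, ?_⟩
  · intro p q p' q' h hp hq
    simp only [Finset.mem_filter, Finset.mem_univ, true_and] at h ⊢
    rw [Fin.le_def] at hp hq
    omega
  · intro p q h
    simp only [Finset.mem_filter, Finset.mem_univ, true_and] at h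
    omega
  · intro p
    simp only [Finset.mem_filter, Finset.mem_univ, true_and, Fin.revPerm_apply, Fin.val_rev]
    omega
  · intro p p' hp _
    rw [Fin.lt_def] at hp
    simp only [Finset.mem_filter, Finset.mem_univ, true_and, Fin.revPerm_apply, Fin.val_rev]
    omega

/-- The sum over the pipe dreams of a dominant permutation is a product over its shape. -/
theorem IsDominantFor.neg_one_pow_mul_pipeSum {K : Type*} [CommRing K] {v : Equiv.Perm (Fin d)}
    {L : PipeDream d} (hv : IsDominantFor v L) (u t : Fin d → K) :
    (-1) ^ permLength v * pipeSum v u t = ∏ c ∈ L, (1 - u c.1 * t c.2) := by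
  rw [pipeSum, hv.pipeDreams_eq, Finset.sum_singleton, hv.permLength_eq_card, ← mul_assoc,
    ← mul_pow]
  simp

theorem neg_one_pow_permLength_mul_swap {R : Type*} [Ring R] (v : Equiv.Perm (Fin d))
    {a b : Fin d} (hab : a ≠ b) :
    (-1 : R) ^ permLength (v * Equiv.swap a b) = -(-1) ^ permLength v := by
  have h := sign_eq_neg_one_pow_permLength (v * Equiv.swap a b)
  rw [Equiv.Perm.sign_mul, Equiv.Perm.sign_swap hab, sign_eq_neg_one_pow_permLength] at h
  have h' := congrArg (fun e : ℤˣ => ((e : ℤ) : R)) h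
  simpa using h'.symm

/-- The Fomin–Kirillov formula. -/
theorem IsDoubleGrothendieck.eq_pipeSum {v : Equiv.Perm (Fin d)} {f : RatFun d}
    (h : IsDoubleGrothendieck v f) :
    f = (-1) ^ permLength v * pipeSum v zVar fun q => (zDot q)⁻¹ := by
  induction h with
  | top =>
    rw [isDominantFor_revPerm.neg_one_pow_mul_pipeSum]
    simp only [div_eq_mul_inv]
  | @step v f a b hab _ hv ih =>
    have hne : a ≠ b := by
      rintro rfl
      exact lt_irrefl _ hv
    have hz : (zVar b : RatFun d) - zVar a ≠ 0 :=
      sub_ne_zero.2 (zVar_injective.ne hne.symm)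
    have ha := zVar_ne_zero a
    have hs : swapZ a b (pipeSum v zVar fun q => (zDot q)⁻¹) =
        pipeSum v ((zVar : Fin d → RatFun d) ∘ Equiv.swap a b) fun q => (zDot q)⁻¹ := by
      rw [← RingEquiv.coe_toRingHom, map_pipeSum]
      congr 1
      · ext p
        exact swapZ_zVar a b p
      · ext q
        simp [swapZ_zDot]
    rw [demazureOp, ih, map_mul, map_pow, map_neg, map_one, hs,
      pipeSum_comp_swap_of_gt _ _ hab ha hv, neg_one_pow_permLength_mul_swap v hne,
      div_eq_iff hz]
    field_simp
    ring

theorem doubleGrothendieck_eq_pipeSum (v : Equiv.Perm (Fin d)) :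
    doubleGrothendieck v = (-1) ^ permLength v * pipeSum v zVar fun q => (zDot q)⁻¹ :=
  (Classical.choose_spec (exists_isDoubleGrothendieck v)).eq_pipeSum

end RatFun

/-! ### Symmetry in the variables of a block -/

/-- A function of `d` variables that is invariant under exchanging adjacent variables of the same
block is invariant under all permutations preserving the blocks. -/
theorem comp_eq_of_comp_adjacent_swap_eq {d : ℕ} {β K X : Type*} [Zero K] (B : Fin d → β)
    (hB : ∀ a b c, a ≤ b → b ≤ c → B a = B c → B a = B b) (f : (Fin d → K) → X)
    (hf : ∀ (u : Fin d → K) (a b : Fin d), (∀ p, u p ≠ 0) → (b : ℕ) = a + 1 → B a = B b →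
      f (u ∘ Equiv.swap a b) = f u)
    (σ : Equiv.Perm (Fin d)) (hσ : ∀ p, B (σ p) = B p) (u : Fin d → K) (hu : ∀ p, u p ≠ 0) :
    f (u ∘ σ) = f u := by
  let S : Set (Equiv.Perm (Fin d)) :=
    {τ | ∃ a b : Fin d, (b : ℕ) = a + 1 ∧ B a = B b ∧ τ = Equiv.swap a b}
  have hS : ∀ τ ∈ S, τ.IsSwap := by
    rintro _ ⟨a, b, hab, -, rfl⟩
    exact ⟨a, b, fun h => by rw [h] at hab; omega, rfl⟩
  have hclos : ∀ τ ∈ Subgroup.closure S, ∀ u : Fin d → K, (∀ p, u p ≠ 0) → f (u ∘ τ) = f u := by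
    intro τ hτ
    induction hτ using Subgroup.closure_induction with
    | mem τ hτ =>
      obtain ⟨a, b, hab, hBab, rfl⟩ := hτ
      exact fun u hu => hf u a b hu hab hBab
    | one => intro u _; rfl
    | mul τ τ' _ _ h h' =>
      intro u hu
      rw [← h u hu, ← h' (u ∘ τ) fun p => hu _]
      rfl
    | inv τ _ h =>
      intro u hu
      rw [← h (u ∘ ⇑τ⁻¹) fun p => hu _]
      congr 1
      ext p
      simp
  have horb : ∀ k : ℕ, ∀ a c : Fin d, (c : ℕ) = a + k → B a = B c →
      c ∈ MulAction.orbit (Subgroup.closure S) a := by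
    intro k
    induction k with
    | zero =>
      intro a c hac _
      rw [show c = a from Fin.ext hac]
      exact MulAction.mem_orbit_self a
    | succ k ih =>
      intro a c hac hBac
      have hb : (a : ℕ) + k < d := by omega
      have hBab := hB a ⟨a + k, hb⟩ c (Fin.le_def.2 (by simp)) (Fin.le_def.2 (by simp; omega)) hBac
      have h1 := ih a ⟨a + k, hb⟩ rfl hBab
      rw [← MulAction.orbit_eq_iff.2 h1]
      exact ⟨⟨Equiv.swap ⟨a + k, hb⟩ c, Subgroup.subset_closure
        ⟨_, c, by simp only; omega, hBab.symm.trans hBac, rfl⟩⟩, Equiv.swap_apply_left _ _⟩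
  refine hclos σ ((mem_closure_isSwap hS).2 ⟨Set.toFinite _, fun p => ?_⟩) u hu
  rcases le_total p (σ p) with h | h
  · exact horb (σ p - p) p (σ p) (by rw [Fin.le_def] at h; omega) (hσ p).symm
  · rw [MulAction.mem_orbit_symm]
    exact horb (p - σ p) (σ p) p (by rw [Fin.le_def] at h; omega) (hσ p)

section Blocks

variable {n : ℕ} (r : Fin (n + 1) → ℕ)

theorem finSigmaFinEquiv_lt_of_fst_lt {j j' : Fin (n + 1)} (h : j < j') (a : Fin (r j))
    (a' : Fin (r j')) :
    (finSigmaFinEquiv (n := r) ⟨j, a⟩ : ℕ) < finSigmaFinEquiv (n := r) ⟨j', a'⟩ := by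
  let r' : ℕ → ℕ := fun i => if hi : i < n + 1 then r ⟨i, hi⟩ else 0
  have key : ∀ k : Fin (n + 1), ∑ i : Fin (k : ℕ), r (Fin.castLE k.2.le i) =
      ∑ i ∈ Finset.range k, r' i := by
    intro k
    rw [Finset.sum_range]
    refine Finset.sum_congr rfl fun i _ => ?_
    have : (i : ℕ) < n + 1 := by omega
    simp only [r', this, dif_pos]
    rfl
  rw [finSigmaFinEquiv_apply, finSigmaFinEquiv_apply, key, key]
  have h1 : ∑ i ∈ Finset.range (j + 1), r' i ≤ ∑ i ∈ Finset.range j', r' i :=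
    Finset.sum_le_sum_of_subset (Finset.range_subset_range.2 (Fin.lt_def.1 h))
  rw [Finset.sum_range_succ] at h1
  have h2 : r' j = r j := by
    simp only [r', j.2, dif_pos]
  have := a.2
  simp only
  omega

theorem rowBlock_mono : Monotone (rowBlock r) := by
  intro p p' h
  by_contra hlt
  have h1 := finSigmaFinEquiv_lt_of_fst_lt r (not_le.1 hlt) (finSigmaFinEquiv.symm p').2
    (finSigmaFinEquiv.symm p).2
  change (finSigmaFinEquiv (finSigmaFinEquiv.symm p') : ℕ) <
    finSigmaFinEquiv (finSigmaFinEquiv.symm p) at h1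
  rw [Equiv.apply_symm_apply, Equiv.apply_symm_apply] at h1
  rw [Fin.le_def] at h
  omega

theorem colBlock_anti : Antitone (colBlock r) := fun _ _ h =>
  rowBlock_mono r (Fin.rev_le_rev.2 h)

theorem rowBlock_revRow (p : Fin (∑ j, r j)) : rowBlock r (revRow r p) = rowBlock r p := by
  simp [rowBlock, revRow]

theorem colBlock_revCol (q : Fin (∑ j, r j)) : colBlock r (revCol r q) = colBlock r q := by
  rw [colBlock, revCol, Fin.rev_rev, rowBlock_revRow, colBlock]

theorem revRow_involutive : Function.Involutive (revRow r) := by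
  have key : ∀ s : (j : Fin (n + 1)) × Fin (r j),
      revRow r (finSigmaFinEquiv s) = finSigmaFinEquiv ⟨s.1, s.2.rev⟩ := by
    intro s
    rw [revRow, Equiv.symm_apply_apply]
  intro p
  obtain ⟨s, rfl⟩ := finSigmaFinEquiv.surjective p
  rw [key, key, Fin.rev_rev]

theorem revCol_involutive : Function.Involutive (revCol r) := by
  intro q
  simp [revCol, revRow_involutive r _]

/-- The sum over the pipe dreams of a Zelevinsky permutation is unchanged when each row alphabet
and each column alphabet is reversed. -/
theorem IsZelevinsky.pipeSum_comp_rev {K : Type*} [Field K] {v : Equiv.Perm (Fin (∑ j, r j))}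
    (hv : IsZelevinsky r v) (u t : Fin (∑ j, r j) → K) (hu : ∀ p, u p ≠ 0) (ht : ∀ q, t q ≠ 0) :
    pipeSum v (u ∘ revRow r) (t ∘ revCol r) = pipeSum v u t := by
  have h1 := comp_eq_of_comp_adjacent_swap_eq (rowBlock r)
    (fun a b c hab hbc h => le_antisymm (rowBlock_mono r hab) (h ▸ rowBlock_mono r hbc))
    (fun u => pipeSum v u (t ∘ revCol r))
    (fun u a b hu hab hB => pipeSum_comp_swap_of_lt u _ hab (hu a)
      (hv.row_block a b hB (Fin.lt_def.2 (by omega))))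
    (revRow_involutive r).toPerm (rowBlock_revRow r) u hu
  have h2 := comp_eq_of_comp_adjacent_swap_eq (colBlock r)
    (fun a b c hab hbc h => le_antisymm (h ▸ colBlock_anti r hbc) (colBlock_anti r hab))
    (fun t => pipeSum v u t)
    (fun t a b ht hab hB => pipeSum_comp_swap_col u t hab (ht a) (by
      by_contra hcon
      have hab' : a < b := Fin.lt_def.2 (by omega)
      have hne : v.symm b ≠ v.symm a := v.symm.injective.ne hab'.ne'
      have := hv.col_block (v.symm b) (v.symm a) (by simpa using hB.symm)
        (lt_of_le_of_ne (not_lt.1 hcon) hne)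
      rw [Equiv.apply_symm_apply, Equiv.apply_symm_apply] at this
      exact lt_asymm hab' this))
    (revCol_involutive r).toPerm (colBlock_revCol r) t ht
  exact h1.trans h2

end Blocks

/-! ### The maximal Zelevinsky permutation -/

/-- Counting the complement of a pair of conditions on a permutation. -/
theorem card_filter_notMem_add {d : ℕ} (v : Equiv.Perm (Fin d)) (A C : Finset (Fin d)) :
    ((Finset.univ : Finset (Fin d)).filter fun p => p ∉ A ∧ v p ∉ C).card + A.card + C.card =
      d + ((Finset.univ : Finset (Fin d)).filter fun p => p ∈ A ∧ v p ∈ C).card := by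
  have hC : ((Finset.univ : Finset (Fin d)).filter fun p => v p ∈ C).card = C.card := by
    refine Finset.card_bij (fun p _ => v p) (by simp) (fun _ _ _ _ h => v.injective h) ?_
    exact fun c hc => ⟨v.symm c, by simpa using hc, by simp⟩
  have h1 := Finset.card_union_add_card_inter A
    ((Finset.univ : Finset (Fin d)).filter fun p => v p ∈ C)
  have h2 := Finset.card_compl_add_card
    (A ∪ (Finset.univ : Finset (Fin d)).filter fun p => v p ∈ C)
  have h3 : (A ∪ (Finset.univ : Finset (Fin d)).filter fun p => v p ∈ C)ᶜ =
      (Finset.univ : Finset (Fin d)).filter fun p => p ∉ A ∧ v p ∉ C := by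
    ext p; simp
  have h4 : (A ∩ (Finset.univ : Finset (Fin d)).filter fun p => v p ∈ C) =
      (Finset.univ : Finset (Fin d)).filter fun p => p ∈ A ∧ v p ∈ C := by
    ext p; simp
  rw [h3, Fintype.card_fin] at h2
  rw [h4, hC] at h1
  omega

/-- Among all permutations avoiding the shape `L`, the dominant one has the largest number of
ones in every northwest rectangle `A × C`. Take the last column `c` of `C` without a one of `h` in
the rows `A`: all rows of `A` in which column `c` is not in `L` have their one left of `c`, and all
later columns of `C` are used. -/
theorem IsDominantFor.card_le {d : ℕ} {h v : Equiv.Perm (Fin d)} {L : PipeDream d}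
    (hh : IsDominantFor h L) (hv : ∀ p, (p, v p) ∉ L) {A C : Finset (Fin d)}
    (hA : ∀ p ∈ A, ∀ p' ≤ p, p' ∈ A) (hC : ∀ q ∈ C, ∀ q' ≤ q, q' ∈ C) :
    ((Finset.univ : Finset (Fin d)).filter fun p => p ∈ A ∧ v p ∈ C).card ≤
      ((Finset.univ : Finset (Fin d)).filter fun p => p ∈ A ∧ h p ∈ C).card := by
  by_cases hne : (C.filter fun c => h.symm c ∉ A).Nonempty
  · obtain ⟨c, hc, hmax⟩ := Finset.exists_max_image _ id hne
    obtain ⟨hcC, hcA⟩ := Finset.mem_filter.1 hc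
    have hleft : ∀ p ∈ A, (p, c) ∉ L → h p < c := by
      intro p hp hpc
      rcases lt_trichotomy (h p) c with hlt | heq | hgt
      · exact hlt
      · exact absurd hp (by rwa [← heq, Equiv.symm_apply_apply] at hcA)
      · refine absurd (hh.mem_of_inversion (p' := h.symm c) ?_ (by simpa using hgt)) (by simpa)
        exact not_le.1 fun hle => hcA (hA p hp _ hle)
    have h1 : (A.filter fun p => (p, c) ∉ L).card + (C.filter fun q => c < q).card ≤
        ((Finset.univ : Finset (Fin d)).filter fun p => p ∈ A ∧ h p ∈ C).card := by
      rw [← Finset.card_map h.symm.toEmbedding (s := C.filter fun q => c < q),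
        ← Finset.card_union_of_disjoint]
      · refine Finset.card_le_card fun p hp => ?_
        simp only [Finset.mem_filter, Finset.mem_univ, true_and]
        rcases Finset.mem_union.1 hp with hp | hp
        · obtain ⟨hpA, hpc⟩ := Finset.mem_filter.1 hp
          exact ⟨hpA, hC c hcC _ (hleft p hpA hpc).le⟩
        · obtain ⟨q, hq, rfl⟩ := Finset.mem_map.1 hp
          obtain ⟨hqC, hcq⟩ := Finset.mem_filter.1 hq
          refine ⟨?_, by simpa using hqC⟩
          by_contra hcon
          exact absurd (hmax q (Finset.mem_filter.2 ⟨hqC, hcon⟩)) (not_le.2 hcq)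
      · rw [Finset.disjoint_left]
        intro p hp hp'
        obtain ⟨hpA, hpc⟩ := Finset.mem_filter.1 hp
        obtain ⟨q, hq, rfl⟩ := Finset.mem_map.1 hp'
        have := hleft _ hpA hpc
        simp only [Equiv.coe_toEmbedding, Equiv.apply_symm_apply] at this
        exact lt_asymm this (Finset.mem_filter.1 hq).2
    refine le_trans ?_ h1
    rw [← Finset.card_map v.symm.toEmbedding (s := C.filter fun q => c < q)]
    refine le_trans (Finset.card_le_card fun p hp => ?_) (Finset.card_union_le _ _)
    simp only [Finset.mem_filter, Finset.mem_univ, true_and] at hp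
    rw [Finset.mem_union]
    rcases le_or_gt (v p) c with hpc | hpc
    · exact Or.inl (Finset.mem_filter.2 ⟨hp.1, fun hcon => hv p (hh.mem_of_le hcon le_rfl hpc)⟩)
    · exact Or.inr (Finset.mem_map.2 ⟨v p, Finset.mem_filter.2 ⟨hp.2, hpc⟩, by simp⟩)
  · have hall : ∀ q ∈ C, h.symm q ∈ A := fun q hq => by
      by_contra hcon
      exact hne ⟨q, Finset.mem_filter.2 ⟨hq, hcon⟩⟩
    calc _ ≤ C.card := Finset.card_le_card_of_injOn v (fun p hp => (Finset.mem_filter.1 hp).2.2)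
          v.injective.injOn
      _ = (C.map h.symm.toEmbedding).card := (Finset.card_map _).symm
      _ ≤ _ := Finset.card_le_card fun p hp => by
        obtain ⟨q, hq, rfl⟩ := Finset.mem_map.1 hp
        simpa using ⟨hall q hq, hq⟩

section Zelevinsky

variable {n : ℕ} {r : Fin (n + 1) → ℕ} {v h : Equiv.Perm (Fin (∑ j, r j))}

theorem mem_dHom {p q : Fin (∑ j, r j)} :
    (p, q) ∈ dHom r ↔ (rowBlock r p : ℕ) + 2 ≤ (colBlock r q : ℕ) := by
  simp [dHom]

theorem dHom_mem_of_le {p q p' q' : Fin (∑ j, r j)} (hpq : (p, q) ∈ dHom r) (hp : p' ≤ p)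
    (hq : q' ≤ q) : (p', q') ∈ dHom r := by
  rw [mem_dHom] at hpq ⊢
  have h1 := Fin.le_def.1 (rowBlock_mono r hp)
  have h2 := Fin.le_def.1 (colBlock_anti r hq)
  omega

theorem dHom_add_lt {p q : Fin (∑ j, r j)} (hpq : (p, q) ∈ dHom r) :
    (p : ℕ) + q + 1 < ∑ j, r j := by
  rw [mem_dHom] at hpq
  have h1 : p < q.rev := by
    by_contra hcon
    have := Fin.le_def.1 (rowBlock_mono r (not_lt.1 hcon))
    rw [colBlock] at hpq
    omega
  rw [Fin.lt_def, Fin.val_rev] at h1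
  omega

/-- The rows above block row `j` and the columns left of block column `i` turn the rank `r_{ij}`
into a count in a northwest rectangle. -/
theorem rankArray_add (v : Equiv.Perm (Fin (∑ j, r j))) (i j : Fin (n + 1)) :
    rankArray r v i j + ((Finset.univ : Finset (Fin (∑ j, r j))).filter
        fun p => rowBlock r p < j).card +
      ((Finset.univ : Finset (Fin (∑ j, r j))).filter fun q => i < colBlock r q).card =
      (∑ j, r j) + ((Finset.univ : Finset (Fin (∑ j, r j))).filter fun p =>
        rowBlock r p < j ∧ i < colBlock r (v p)).card := by
  have := card_filter_notMem_add v
    ((Finset.univ : Finset (Fin (∑ j, r j))).filter fun p => rowBlock r p < j)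
    ((Finset.univ : Finset (Fin (∑ j, r j))).filter fun q => i < colBlock r q)
  simp only [Finset.mem_filter, Finset.mem_univ, true_and, not_lt] at this
  exact this

theorem IsDominantFor.isZelevinsky (hh : IsDominantFor h (dHom r)) : IsZelevinsky r h := by
  refine ⟨fun p hp => hh.notMem p (mem_dHom.2 hp), fun p p' hb hlt => ?_, fun p p' hb hlt => ?_⟩
  · by_contra hcon
    have h1 := hh.mem_of_inversion hlt
      (lt_of_le_of_ne (not_lt.1 hcon) (h.injective.ne hlt.ne'))
    rw [mem_dHom, hb, ← mem_dHom] at h1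
    exact hh.notMem p' h1
  · by_contra hcon
    have h1 := hh.mem_of_inversion hlt
      (lt_of_le_of_ne (not_lt.1 hcon) (h.injective.ne hlt.ne'))
    rw [mem_dHom, ← hb, ← mem_dHom] at h1
    exact hh.notMem p h1

theorem IsDominantFor.rankArray_le (hh : IsDominantFor h (dHom r)) (hv : IsZelevinsky r v)
    (i j : Fin (n + 1)) : rankArray r v i j ≤ rankArray r h i j := by
  have h1 := rankArray_add v i j
  have h2 := rankArray_add h i j
  have h3 := hh.card_le (v := v) (fun p hp => hv.zero_block p (mem_dHom.1 hp))
    (A := (Finset.univ : Finset (Fin (∑ j, r j))).filter fun p => rowBlock r p < j)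
    (C := (Finset.univ : Finset (Fin (∑ j, r j))).filter fun q => i < colBlock r q)
    (fun p hp p' hpp' => by
      simp only [Finset.mem_filter, Finset.mem_univ, true_and] at hp ⊢
      exact (rowBlock_mono r hpp').trans_lt hp)
    (fun q hq q' hqq' => by
      simp only [Finset.mem_filter, Finset.mem_univ, true_and] at hq ⊢
      exact hq.trans_le (colBlock_anti r hqq'))
  simp only [Finset.mem_filter, Finset.mem_univ, true_and] at h3
  omega

/-- A Zelevinsky permutation with the same ranks as the dominant permutation `h` of the shape
`D_Hom` is equal to `h`. In the first row `p` where `v` and `h` differ, `h` has its one further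
left, hence in a block column further left, and a rank distinguishes `v` from `h`. -/
theorem IsDominantFor.eq_of_rankArray_eq (hh : IsDominantFor h (dHom r)) (hv : IsZelevinsky r v)
    (hrank : ∀ i j, i ≤ j → rankArray r v i j = rankArray r h i j) : v = h := by
  have hz := hh.isZelevinsky
  apply Equiv.ext
  intro p
  induction p using WellFoundedLT.induction with
  | ind p ih =>
    rcases lt_trichotomy (v p) (h p) with hlt | heq | hgt
    · exfalso
      have h1 : p < h.symm (v p) := by
        by_contra h1
        rcases (not_lt.1 h1).lt_or_eq with h1 | h1
        · have := ih _ h1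
          rw [Equiv.apply_symm_apply] at this
          exact h1.ne (v.injective this)
        · have := congrArg h h1
          rw [Equiv.apply_symm_apply] at this
          exact hlt.ne this
      have h2 := hh.mem_of_inversion h1 (by simpa using hlt)
      rw [Equiv.apply_symm_apply] at h2
      exact hv.zero_block p (mem_dHom.1 h2)
    · exact heq
    · exfalso
      obtain ⟨p'', hp''⟩ : ∃ p'', v p'' = h p := ⟨v.symm (h p), by simp⟩
      have hpp'' : p < p'' := by
        rcases lt_trichotomy p p'' with h1 | h1 | h1
        · exact h1
        · rw [← h1] at hp''
          exact absurd hp'' hgt.ne'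
        · rw [ih p'' h1] at hp''
          exact absurd (h.injective hp'') h1.ne
      have hcol : colBlock r (v p) < colBlock r (h p) := by
        refine lt_of_le_of_ne (colBlock_anti r hgt.le) fun heq => ?_
        have := hv.col_block p p'' (by rw [heq, hp'']) hpp''
        rw [hp''] at this
        exact lt_asymm hgt this
      have hrow : rowBlock r p < rowBlock r p'' := by
        refine lt_of_le_of_ne (rowBlock_mono r hpp''.le) fun heq => ?_
        have := hv.row_block p p'' heq hpp''
        rw [hp''] at this
        exact lt_asymm hgt this
      have hzero := hz.zero_block p
      -- the block southeast of the block of `(p, h p)`, in the next block row and block column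
      obtain ⟨i, hi⟩ : ∃ i : Fin (n + 1), (i : ℕ) + 1 = colBlock r (h p) := by
        have := Fin.lt_def.1 hcol
        exact ⟨⟨colBlock r (h p) - 1, by omega⟩, by simp only; omega⟩
      obtain ⟨j, hj⟩ : ∃ j : Fin (n + 1), (j : ℕ) = rowBlock r p + 1 := by
        have := Fin.lt_def.1 hrow
        exact ⟨⟨rowBlock r p + 1, by omega⟩, rfl⟩
      have hij := hrank i j (Fin.le_def.2 (by omega))
      have h1 := rankArray_add v i j
      have h2 := rankArray_add h i j
      have h3 : ((Finset.univ : Finset (Fin (∑ j, r j))).filter fun p =>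
          rowBlock r p < j ∧ i < colBlock r (v p)) ⊂
          (Finset.univ : Finset (Fin (∑ j, r j))).filter fun p =>
            rowBlock r p < j ∧ i < colBlock r (h p) := by
        have hpv : ¬ i < colBlock r (v p) := by
          rw [Fin.lt_def] at hcol ⊢
          omega
        rw [Finset.ssubset_iff_of_subset]
        · refine ⟨p, ?_, ?_⟩
          · simp only [Finset.mem_filter, Finset.mem_univ, true_and, Fin.lt_def]
            omega
          · simp [hpv]
        · intro x hx
          simp only [Finset.mem_filter, Finset.mem_univ, true_and] at hx ⊢
          have hxp : x < p := by
            by_contra hcon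
            refine hpv (hx.2.trans_le (colBlock_anti r ?_))
            rcases (not_lt.1 hcon).lt_or_eq with hlt | rfl
            · refine (hv.row_block p x (le_antisymm (rowBlock_mono r hlt.le) ?_) hlt).le
              have := Fin.lt_def.1 hx.1
              exact Fin.le_def.2 (by omega)
            · exact le_rfl
          rw [← ih x hxp]
          exact hx
      have h4 := Finset.card_lt_card h3
      omega

theorem exists_isDominantFor_dHom (r : Fin (n + 1) → ℕ) :
    ∃ h : Equiv.Perm (Fin (∑ j, r j)), IsDominantFor h (dHom r) := by
  obtain ⟨h, hh, -⟩ := exists_isDominantFor (L := dHom r) dHom_mem_of_le dHom_add_lt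
  exact ⟨h, hh⟩

/-- `v(Hom)` is the dominant permutation of the shape `D_Hom`. -/
theorem isZelevinskyHom_iff_isDominantFor : IsZelevinskyHom r h ↔ IsDominantFor h (dHom r) := by
  refine ⟨fun hz => ?_, fun hh => ⟨hh.isZelevinsky, fun v hv i j _ => hh.rankArray_le hv i j⟩⟩
  obtain ⟨h', hh'⟩ := exists_isDominantFor_dHom r
  rwa [hh'.eq_of_rankArray_eq hz.1 fun i j hij =>
    le_antisymm (hh'.rankArray_le hz.1 i j) (hz.2 h' hh'.isZelevinsky i j hij)]

theorem dHom_subset_of_mem_pipeDreams (hv : IsZelevinsky r v) {P : PipeDream (∑ j, r j)}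
    (hP : P ∈ pipeDreams v) : dHom r ⊆ P := by
  rintro ⟨p, q⟩ hpq
  refine mem_of_mem_pipeDreams hP fun p' hp' => ?_
  by_contra hcon
  exact hv.zero_block p' (mem_dHom.1 (dHom_mem_of_le hpq hp' (not_lt.1 hcon)))

/-! ### Double quiver `K`-polynomials -/

theorem IsZelevinsky.pipeSum_eq (hv : IsZelevinsky r v) :
    (pipeSum v zVar fun q => (zDot q)⁻¹ : RatFun (∑ j, r j)) =
      ∑ P ∈ pipeDreams v, (-1) ^ P.card * expRevMonomial r P := by
  rw [← hv.pipeSum_comp_rev r _ _ zVar_ne_zero fun q => inv_ne_zero (zDot_ne_zero q), pipeSum]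
  simp only [expRevMonomial, div_eq_mul_inv, Function.comp_apply]

theorem expRevMonomial_ne_zero (P : PipeDream (∑ j, r j)) : expRevMonomial r P ≠ 0 := by
  refine Finset.prod_ne_zero_iff.2 fun c _ => sub_ne_zero.2 fun heq => ?_
  exact zVar_ne_zDot _ _ ((div_eq_one_iff_eq (zDot_ne_zero _)).1 heq.symm)

theorem expRevMonomial_mem_laurentRing (P : PipeDream (∑ j, r j)) :
    expRevMonomial r P ∈ laurentRing (∑ j, r j) := by
  refine Subring.prod_mem _ fun c _ => Subring.sub_mem _ (Subring.one_mem _) ?_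
  rw [div_eq_mul_inv]
  exact Subring.mul_mem _
    (Subring.subset_closure (Or.inl (Or.inl (Or.inl ⟨_, rfl⟩))))
    (Subring.subset_closure (Or.inr ⟨_, rfl⟩))

theorem IsZelevinskyHom.doubleGrothendieck_eq (hh : IsZelevinskyHom r h) :
    doubleGrothendieck h = expRevMonomial r (dHom r) := by
  have hd := isZelevinskyHom_iff_isDominantFor.1 hh
  rw [doubleGrothendieck_eq_pipeSum, hh.1.pipeSum_eq, hd.pipeDreams_eq, Finset.sum_singleton,
    hd.permLength_eq_card, ← mul_assoc, ← mul_pow]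
  simp

theorem IsZelevinsky.doubleGrothendieck_eq (hv : IsZelevinsky r v) :
    doubleGrothendieck v = expRevMonomial r (dHom r) *
      ∑ P ∈ pipeDreams v,
        (-1 : RatFun (∑ j, r j)) ^ ((P.card : ℤ) - (permLength v : ℤ)) *
          expRevMonomial r (P \ dHom r) := by
  rw [doubleGrothendieck_eq_pipeSum, hv.pipeSum_eq, Finset.mul_sum, Finset.mul_sum]
  refine Finset.sum_congr rfl fun P hP => ?_
  have h1 : expRevMonomial r P = expRevMonomial r (P \ dHom r) * expRevMonomial r (dHom r) :=
    (Finset.prod_sdiff (dHom_subset_of_mem_pipeDreams hv hP)).symm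
  have h2 : ((-1 : RatFun (∑ j, r j)) ^ permLength v)⁻¹ = (-1) ^ permLength v := by
    rw [← inv_pow, inv_neg_one]
  rw [h1, zpow_sub₀ (by simp), zpow_natCast, zpow_natCast, div_eq_mul_inv, h2]
  ring

end Zelevinsky

theorem theorem2p2 {n : ℕ} (r : Fin (n + 1) → ℕ) :
    (∃! h : Equiv.Perm (Fin (∑ j, r j)), IsZelevinskyHom r h) ∧
    ∀ v h : Equiv.Perm (Fin (∑ j, r j)), IsZelevinsky r v → IsZelevinskyHom r h →
      doubleGrothendieck h ≠ 0 ∧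
      quiverKPolynomial v h =
        ∑ P ∈ pipeDreams v,
          (-1 : RatFun (∑ j, r j)) ^ ((P.card : ℤ) - (permLength v : ℤ)) *
            expRevMonomial r (P \ dHom r) ∧
      ∃ Gv Gh : laurentRing (∑ j, r j),
        (Gv : RatFun (∑ j, r j)) = doubleGrothendieck v ∧
        (Gh : RatFun (∑ j, r j)) = doubleGrothendieck h ∧ Gh ∣ Gv := by
  refine ⟨?_, fun v h hv hh => ⟨?_, ?_, ?_⟩⟩
  · obtain ⟨h, hh⟩ := exists_isDominantFor_dHom r
    exact ⟨h, isZelevinskyHom_iff_isDominantFor.2 hh, fun h' hh' =>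
      (isZelevinskyHom_iff_isDominantFor.1 hh').eq hh⟩
  · rw [hh.doubleGrothendieck_eq]
    exact expRevMonomial_ne_zero _
  · rw [quiverKPolynomial, hv.doubleGrothendieck_eq, hh.doubleGrothendieck_eq,
      mul_div_cancel_left₀ _ (expRevMonomial_ne_zero _)]
  · have hunit : ∀ k : ℤ, (-1 : RatFun (∑ j, r j)) ^ k ∈ laurentRing (∑ j, r j) := by
      intro k
      rcases Int.even_or_odd k with hk | hk
      · rw [hk.neg_one_zpow]
        exact Subring.one_mem _
      · rw [hk.neg_one_zpow]
        exact Subring.neg_mem _ (Subring.one_mem _)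
    have hsum := Subring.sum_mem (laurentRing (∑ j, r j)) (t := pipeDreams v)
      (f := fun P => (-1 : RatFun (∑ j, r j)) ^ ((P.card : ℤ) - (permLength v : ℤ)) *
        expRevMonomial r (P \ dHom r))
      fun P _ => Subring.mul_mem _ (hunit _) (expRevMonomial_mem_laurentRing _)
    have hE := expRevMonomial_mem_laurentRing (r := r) (dHom r)
    refine ⟨⟨_, hE⟩ * ⟨_, hsum⟩, ⟨_, hE⟩, ?_, hh.doubleGrothendieck_eq.symm,
      Dvd.intro _ rfl⟩
    rw [hv.doubleGrothendieck_eq]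
    rfl
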